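/- **Setting.** Let $\mathcal X\subset\mathbb R^n$, let $\mathcal U\subset\mathbb R^m$ be nonempty, let $\Xi\subset\mathbb R^{d}$ be closed, $\Theta\subset\mathbb R^{k}$, let $\mathcal H$ be a finite set, $\gamma\in(0,1)$, let $c:\mathcal X\times\mathcal U\times\Xi\to\mathbb R$ be bounded and measurable and $F:\mathcal X\times\mathcal U\times\Xi\to\mathcal X$ measurable. Let $\varpi=(\varpi_{h,h'})_{h,h'\in\mathcal H}$ be a transition matrix with stationary distribution $\nu$. For each $\eta\in\mathcal H$ let $q(\cdot|\eta)$ be a probability density on $\Xi$, for each $\eta\in\mathcal H$, $\theta\in\Theta$ let $f(\cdot|\eta,\theta)$ be a probability density on $\Xi$, and let $p$ be a (prior) probability density on $\Theta$, all with respect to Lebesgue measure. The data $(\xi_i,\eta_i)_{i\ge1}$ have the following law $\mathbb P^*$: $\eta_1$ is deterministic, $(\eta_i)$ is a Markov chain with transition matrix $\varpi$, and, given $(\eta_i)$, the $\xi_i$ are independent with densities $q(\cdot|\eta_i)$. The posterior density after $N$ observations is $$\mathsf p_N(\theta)=\frac{\mathsf f_N(\theta)p(\theta)}{\int_\Theta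 \mathsf f_N(\theta')p(\theta')\,d\theta'},\qquad \mathsf f_N(\theta)=f(\xi_1|\eta_1,\theta)\prod_{i=2}^N f(\xi_i|\eta_i,\theta)\,\varpi_{\eta_{i-1},\eta_i}.$$ The true value function $V^*$ and the Bayesian value function $V_N^*$ are the unique bounded functions on $\mathcal X\times\mathcal H$ that satisfy, for all $(x,\eta)\in\mathcal X\times\mathcal H$, $$V^*(x,\eta)=\inf_{u\in\mathcal U}\mathbb E_{\xi\sim q(\cdot|\eta)}\Big[c(x,u,\xi)+\gamma\sum_{\eta'\in\mathcal H}\varpi_{\eta,\eta'}V^*(F(x,u,\xi),\eta')\Big],$$ $$V^*_N(x,\eta)=\inf_{u\in\mathcal U}\mathbb E_{\mathsf p_N|\eta}\Big[c(x,u,\xi)+\gamma\sum_{\eta'\in\mathcal H}\varpi_{\eta,\eta'}V^*_N(F(x,u,\xi),\eta')\Big],$$ where $\mathbb E_{\mathsf p_N|\eta}[Y]=\int_\Theta\int_\Xi Y(\xi)f(\xi|\eta,\theta)\,\mathsf p_N(\theta)\,d\xi\,d\theta$ for bounded measurable $Y$. If a bounded integrand $Y$ is not measurable, its expectation is understood as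 the outer expectation $\inf\{\mathbb E[g]: g \text{ bounded measurable},\ g\ge Y\}$, which is the usual expectation when $Y$ is measurable. **Assumptions.** (i) $\Theta$ is compact with nonempty interior. (ii) There are constants $c_1\ge c_2>0$ with $c_1\ge p(\theta)\ge c_2$ for all $\theta\in\Theta$. (iii) $f(\xi|\eta,\theta)>0$ for all $(\xi,\eta,\theta)$. (iv) For every $(\xi,\eta)\in\Xi\times\mathcal H$, $\theta\mapsto f(\xi|\eta,\theta)$ is continuous on $\Theta$. (v) $\varpi$ is irreducible and aperiodic. (vi) There is $G$, integrable with respect to the stationary law $dP^*(\xi,\eta)=\nu(\eta)q(\xi|\eta)\,d\xi$, such that for $P^*$-almost every $(\xi,\eta)$ one has $|\log f(\xi|\eta,\theta)|\le G(\xi,\eta)$ for all $\theta\in\Theta$. Moreover there is $\theta^*\in\operatorname{int}(\Theta)$ such that $q(\cdot|\eta)=f(\cdot|\eta,\theta^*)$ for all $\eta\in\mathcal H$ (correct specification) and such that $\theta'\in\Theta$, $f(\cdot|\eta,\theta')=f(\cdot|\eta,\theta^*)$ for all $\eta\in\mathcal H$, implies $\theta'=\theta^*$ (identifiability). **Claim.**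 The true value function $V^*$ exists, $\mathbb P^*$-almost surely the Bayesian value functions $V_N^*$ exist for all $N\ge1$, and, $\mathbb P^*$-almost surely, $$\|V_N^*-V^*\|_\infty=\sup_{(x,\eta)\in\mathcal X\times\mathcal H}|V_N^*(x,\eta)-V^*(x,\eta)|\to0\quad\text{as }N\to\infty.$$ -/

import Mathlib

open MeasureTheory Filter Topology

-- Lebesgue measure on a subset of a Euclidean space
attribute [local instance] Measure.Subtype.measureSpace

namespace ContextualControl

/-! ### Densities and the context chain -/

/-- `g` is a probability density with respect to the reference (Lebesgue) measure of `S`. -/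
structure IsDensity {S : Type*} [MeasureSpace S] (g : S → ℝ) : Prop where
  measurable : Measurable g
  nonneg : ∀ s, 0 ≤ g s
  integrable : Integrable g
  integral_eq_one : ∫ s, g s = 1

/-- `ν` is a stationary distribution of the finite-state chain with transition matrix `ϖ`. -/
structure IsStationary {H : Type*} [Fintype H] (ϖ : Matrix H H ℝ) (ν : H → ℝ) : Prop where
  nonneg : ∀ h, 0 ≤ ν h
  sum_eq_one : ∑ h, ν h = 1
  invariant : ∀ h', ∑ h, ν h * ϖ h h' = ν h'

/-- Every state has period one: the greatest common divisor of the possible return times is `1`. -/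
def IsAperiodic {H : Type*} [Fintype H] [DecidableEq H] (ϖ : Matrix H H ℝ) : Prop :=
  ∀ (h : H) (d : ℕ), (∀ k : ℕ, 1 ≤ k → 0 < (ϖ ^ k) h h → d ∣ k) → d = 1

/-- The stationary law `ν(η) q(ξ | η) dξ` of the pair `(ξ, η)`. -/
noncomputable def stationaryLaw {S H : Type*} [MeasureSpace S] [Fintype H] [MeasurableSpace H]
    (ν : H → ℝ) (q : S → H → ℝ) : Measure (S × H) :=
  ∑ h, ENNReal.ofReal (ν h) •
    (volume.withDensity fun s => ENNReal.ofReal (q s h)).map fun s => (s, h)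

/-- Law of the data. The indices are shifted by one: `ξ i`, `η i` are the observations with
number `i + 1`. The first context is the deterministic value `η₁`, the contexts form a
time-homogeneous Markov chain with transition matrix `ϖ`, and given the contexts the `ξ i` are
independent, `ξ i` having density `q (· | η i)`. This is expressed by the finite-dimensional
distributions of the process. -/
structure IsDataProcess {Ω S H : Type*} [MeasurableSpace Ω] [MeasureSpace S] [MeasurableSpace H]
    [DecidableEq H] (P : Measure Ω) (ϖ : Matrix H H ℝ) (q : S → H → ℝ) (η₁ : H)
    (ξ : ℕ → Ω → S) (η : ℕ → Ω → H) : Prop where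
  measurable_ξ : ∀ i, Measurable (ξ i)
  measurable_η : ∀ i, Measurable (η i)
  law : ∀ (N : ℕ) (h : ℕ → H) (A : ℕ → Set S), (∀ i, MeasurableSet (A i)) →
    P {ω | ∀ i ≤ N, η i ω = h i ∧ ξ i ω ∈ A i} =
      ENNReal.ofReal ((if h 0 = η₁ then 1 else 0) *
        (∏ i ∈ Finset.range N, ϖ (h i) (h (i + 1))) *
        ∏ i ∈ Finset.range (N + 1), ∫ s in A i, q s (h i))

/-! ### Posterior -/

/-- The likelihood `f(ξ₁|η₁,θ) ∏_{i=2}^N f(ξ_i|η_i,θ) ϖ_{η_{i-1},η_i}` of the first `N`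
observations, at the data sequence `y`, `h` (with the same shift of indices). -/
noncomputable def likelihood {S H T : Type*} (f : S → H → T → ℝ) (ϖ : Matrix H H ℝ)
    (y : ℕ → S) (h : ℕ → H) (N : ℕ) (θ : T) : ℝ :=
  (∏ i ∈ Finset.range N, f (y i) (h i) θ) * ∏ i ∈ Finset.range (N - 1), ϖ (h i) (h (i + 1))

/-- The posterior density given the first `N` observations, for the prior density `p`. -/
noncomputable def posterior {S H T : Type*} [MeasureSpace T] (f : S → H → T → ℝ)
    (ϖ : Matrix H H ℝ) (p : T → ℝ) (y : ℕ → S) (h : ℕ → H) (N : ℕ) (θ : T) : ℝ :=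
  likelihood f ϖ y h N θ * p θ / ∫ θ', likelihood f ϖ y h N θ' * p θ'

/-! ### Expectations -/

/-- Expectation of `Y(ξ)` when `ξ` has density `q(· | e)`. -/
noncomputable def condExpect {S H : Type*} [MeasureSpace S] (q : S → H → ℝ) (e : H)
    (Y : S → ℝ) : ℝ :=
  ∫ s, Y s * q s e

/-- Posterior predictive conditional expectation of `Y(ξ)` for a density `pN` on the
parameters. -/
noncomputable def predictiveExpect {S H T : Type*} [MeasureSpace S] [MeasureSpace T]
    (f : S → H → T → ℝ) (pN : T → ℝ) (e : H) (Y : S → ℝ) : ℝ :=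
  ∫ θ, (∫ s, Y s * f s e θ) * pN θ

/-- Bounded random variables on `S`. -/
def IsBoundedRV {S : Type*} [MeasurableSpace S] (g : S → ℝ) : Prop :=
  Measurable g ∧ ∃ C : ℝ, ∀ s, |g s| ≤ C

/-- The outer expectation that extends an expectation `E`, defined on bounded random variables,
to all bounded functions. It gives a meaning to the Bellman operators on all bounded functions:
an infimum over uncountably many controls need not be measurable. On bounded random variables
it is `E` itself, see `outerExpect_condExpect` and `outerExpect_predictiveExpect`. -/
noncomputable def outerExpect {S : Type*} [MeasurableSpace S] (E : (S → ℝ) → ℝ)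
    (Y : S → ℝ) : ℝ :=
  sInf (E '' {g | IsBoundedRV g ∧ ∀ s, Y s ≤ g s})

theorem outerExpect_eq {S : Type*} [MeasurableSpace S] {E : (S → ℝ) → ℝ}
    (hE : ∀ g g', IsBoundedRV g → IsBoundedRV g' → (∀ s, g s ≤ g' s) → E g ≤ E g')
    {Y : S → ℝ} (hY : IsBoundedRV Y) : outerExpect E Y = E Y := by
  refine IsLeast.csInf_eq ⟨⟨Y, ⟨hY, fun s => le_rfl⟩, rfl⟩, ?_⟩
  rintro _ ⟨g, ⟨hg, hle⟩, rfl⟩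
  exact hE _ _ hY hg hle

theorem IsBoundedRV.integrable_mul {S : Type*} [MeasureSpace S] {g k : S → ℝ}
    (hg : IsBoundedRV g) (hk : Integrable k) : Integrable fun s => g s * k s := by
  obtain ⟨hm, C, hC⟩ := hg
  exact hk.bdd_mul (c := C) hm.aestronglyMeasurable (Eventually.of_forall hC)

theorem outerExpect_condExpect {S H : Type*} [MeasureSpace S] {q : S → H → ℝ}
    (hq : ∀ e, IsDensity fun s => q s e) (e : H) {Y : S → ℝ} (hY : IsBoundedRV Y) :
    outerExpect (condExpect q e) Y = ∫ s, Y s * q s e := by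
  refine outerExpect_eq (fun g g' hg hg' hle => ?_) hY
  exact integral_mono (hg.integrable_mul (hq e).integrable) (hg'.integrable_mul (hq e).integrable)
    fun s => mul_le_mul_of_nonneg_right (hle s) ((hq e).nonneg s)

/-! ### Bellman equations -/

/-- The Bellman operator in which the expectation over `ξ`, given the context `e`, is `E e`. -/
noncomputable def bellman {X U S H : Type*} [MeasurableSpace S] [Fintype H]
    (c : X → U → S → ℝ) (F : X → U → S → X) (γ : ℝ) (ϖ : Matrix H H ℝ)
    (E : H → (S → ℝ) → ℝ) (V : X × H → ℝ) (z : X × H) : ℝ :=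
  ⨅ u : U, outerExpect (E z.2) fun s =>
    c z.1 u s + γ * ∑ e', ϖ z.2 e' * V (F z.1 u s, e')

/-- `V` is a bounded solution of the Bellman equation. -/
def IsBellmanSolution {X U S H : Type*} [MeasurableSpace S] [Fintype H]
    (c : X → U → S → ℝ) (F : X → U → S → X) (γ : ℝ) (ϖ : Matrix H H ℝ)
    (E : H → (S → ℝ) → ℝ) (V : X × H → ℝ) : Prop :=
  (∃ C : ℝ, ∀ z, |V z| ≤ C) ∧ ∀ z, V z = bellman c F γ ϖ E V z

/-- `V` is the only bounded solution of the Bellman equation: the value function. -/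
def IsValueFunction {X U S H : Type*} [MeasurableSpace S] [Fintype H]
    (c : X → U → S → ℝ) (F : X → U → S → X) (γ : ℝ) (ϖ : Matrix H H ℝ)
    (E : H → (S → ℝ) → ℝ) (V : X × H → ℝ) : Prop :=
  IsBellmanSolution c F γ ϖ E V ∧ ∀ W, IsBellmanSolution c F γ ϖ E W → W = V

/-! ### Assumptions -/

/-- The assumptions for posterior consistency. -/
structure ConsistencyAssumptions {k : ℕ} {S H : Type*} [MeasureSpace S] [Fintype H]
    [DecidableEq H] [MeasurableSpace H] (Θ : Set (EuclideanSpace ℝ (Fin k)))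
    (p : Θ → ℝ) (f : S → H → Θ → ℝ) (q : S → H → ℝ) (ϖ : Matrix H H ℝ) (ν : H → ℝ) : Prop where
  isCompact : IsCompact Θ
  interior_nonempty : (interior Θ).Nonempty
  prior_bounds : ∃ c₁ c₂ : ℝ, 0 < c₂ ∧ ∀ θ, c₂ ≤ p θ ∧ p θ ≤ c₁
  pos : ∀ s e θ, 0 < f s e θ
  continuous : ∀ s e, Continuous (f s e)
  irreducible : ϖ.IsIrreducible
  aperiodic : IsAperiodic ϖ
  dominated : ∃ G : S × H → ℝ, Integrable G (stationaryLaw ν q) ∧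
    ∀ᵐ z ∂(stationaryLaw ν q), ∀ θ, |Real.log (f z.1 z.2 θ)| ≤ G z

/-- The model is correctly specified, with true parameter `θs`. -/
def IsCorrectlySpecified {S H T : Type*} (f : S → H → T → ℝ) (q : S → H → ℝ) (θs : T) : Prop :=
  ∀ e, (fun s => q s e) = fun s => f s e θs

/-- The model is identifiable at `θs`. -/
def IsIdentifiable {S H T : Type*} (f : S → H → T → ℝ) (θs : T) : Prop :=
  ∀ θ', (∀ e, (fun s => f s e θs) = fun s => f s e θ') → θ' = θs

theorem outerExpect_predictiveExpect {k : ℕ} {S H : Type*} [MeasureSpace S]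
    [SFinite (volume : Measure S)] [Fintype H] [DecidableEq H] [MeasurableSpace H]
    {Θ : Set (EuclideanSpace ℝ (Fin k))} {p : Θ → ℝ} {f : S → H → Θ → ℝ} {q : S → H → ℝ}
    {ϖ : Matrix H H ℝ} {ν : H → ℝ} (hA : ConsistencyAssumptions Θ p f q ϖ ν)
    (hf : ∀ e θ, IsDensity fun s => f s e θ) (hp : IsDensity p)
    (y : ℕ → S) (h : ℕ → H) (N : ℕ) (e : H) {Y : S → ℝ} (hY : IsBoundedRV Y) :
    outerExpect (predictiveExpect f (posterior f ϖ p y h N) e) Y =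
      ∫ θ, (∫ s, Y s * f s e θ) * posterior f ϖ p y h N θ := by
  have : CompactSpace Θ := isCompact_iff_compactSpace.mp hA.isCompact
  have hLnn : ∀ θ, 0 ≤ likelihood f ϖ y h N θ := fun θ =>
    mul_nonneg (Finset.prod_nonneg fun i _ => (hA.pos _ _ _).le)
      (Finset.prod_nonneg fun i _ => hA.irreducible.nonneg _ _)
  have hLc : Continuous (likelihood f ϖ y h N) := by
    unfold likelihood
    exact (continuous_finsetProd _ fun i _ => hA.continuous _ _).mul continuous_const
  have hpn : ∀ θ, 0 ≤ posterior f ϖ p y h N θ := fun θ =>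
    div_nonneg (mul_nonneg (hLnn θ) (hp.nonneg θ))
      (integral_nonneg fun θ => mul_nonneg (hLnn θ) (hp.nonneg θ))
  have hpi : Integrable (posterior f ϖ p y h N) := by
    obtain ⟨C, hC⟩ := isCompact_univ.exists_bound_of_continuousOn hLc.continuousOn
    exact (IsBoundedRV.integrable_mul
      ⟨hLc.measurable, C, fun θ => hC θ (Set.mem_univ _)⟩ hp.integrable).div_const _
  have hfm : Measurable (Function.uncurry fun θ s => f s e θ) :=
    measurable_uncurry_of_continuous_of_measurable (u := fun θ s => f s e θ)
      (fun s => hA.continuous s e) fun θ => (hf e θ).measurable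
  have hin : ∀ g, IsBoundedRV g → IsBoundedRV fun θ => ∫ s, g s * f s e θ := by
    rintro g ⟨hg, C, hC⟩
    refine ⟨?_, C, fun θ => ?_⟩
    · exact (StronglyMeasurable.integral_prod_right (ν := (volume : Measure S))
        (f := fun θ s => g s * f s e θ)
        ((hg.comp measurable_snd).mul hfm).stronglyMeasurable).measurable
    · have hb : ∀ s, ‖g s * f s e θ‖ ≤ C * f s e θ := fun s => by
        rw [norm_mul, Real.norm_of_nonneg ((hf e θ).nonneg s)]
        exact mul_le_mul_of_nonneg_right (hC s) ((hf e θ).nonneg s)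
      calc ‖∫ s, g s * f s e θ‖ ≤ ∫ s, C * f s e θ :=
            norm_integral_le_of_norm_le ((hf e θ).integrable.const_mul C)
              (Eventually.of_forall hb)
        _ = C := by rw [integral_const_mul, (hf e θ).integral_eq_one, mul_one]
  refine outerExpect_eq (fun g g' hg hg' hle => ?_) hY
  refine integral_mono ((hin g hg).integrable_mul hpi) ((hin g' hg').integrable_mul hpi)
    fun θ => mul_le_mul_of_nonneg_right ?_ (hpn θ)
  exact integral_mono (hg.integrable_mul (hf e θ).integrable)
    (hg'.integrable_mul (hf e θ).integrable)
    fun s => mul_le_mul_of_nonneg_right (hle s) ((hf e θ).nonneg s)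

end ContextualControl

namespace ContextualControl

/-! ### Monotone, translation equivariant expectations -/

/-! The argument separates dynamic programming from statistics. For any monotone, translation
equivariant expectation, its outer extension inherits both properties, so the Bellman operator is a
`γ`-contraction in the sup norm on all bounded functions; no measurability of value functions is
needed. Banach's theorem gives `exists_isValueFunction`, and comparing two fixed points gives
`abs_valueFunction_sub_le`: if two expectations differ by at most `δ` on all measurable functions
with a suitable common bound, the value functions differ by at most `δ / (1 - γ)`. It remains to
show that the posterior predictive expectations converge almost surely to the true ones, uniformly
over such functions.

Let `K(θ)` be the sum over the contexts of the relative entropies of the true density with respect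
to `f(·|e,θ)`. A Pinsker-type inequality (`abs_sub_le_entropy`) bounds the predictive error by the
posterior mean of `K`, so that mean has to vanish. By `tendsto_weighted_average_zero` this follows
from likelihood ratios squeezed, uniformly in `θ`, between `exp(-N(K+ε))` and `exp(-N(bK-ε))`, since
the prior charges every set `{K < δ}`. Concentration is thus measured by `K` itself and not by the
distance to the true parameter.

The squeeze has two probabilistic inputs. The first is a strong law for log-likelihood ratios as
random elements of `C(Θ, ℝ)`, each centred by the mean in its own context
(`IsDataProcess.ae_tendsto_average`); it reduces to i.i.d. sequences by reading the data off an
independent array along the context path. The second is that every context has positive lower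
visiting frequency (`IsDataProcess.ae_eventually_le_count`), from a geometric drift function and
Borel–Cantelli. A lower frequency suffices, so no ergodic theorem for the chain enters. -/

/-- The properties of an expectation on bounded random variables that make the Bellman operator
a contraction. -/
structure IsExpectation {S : Type*} [MeasurableSpace S] (E : (S → ℝ) → ℝ) : Prop where
  mono : ∀ g g', IsBoundedRV g → IsBoundedRV g' → (∀ s, g s ≤ g' s) → E g ≤ E g'
  const : ∀ a : ℝ, E (fun _ => a) = a
  add_const : ∀ g (a : ℝ), IsBoundedRV g → E (fun s => g s + a) = E g + a

theorem isBoundedRV_const {S : Type*} [MeasurableSpace S] (a : ℝ) :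
    IsBoundedRV fun _ : S => a :=
  ⟨measurable_const, |a|, fun _ => le_rfl⟩

theorem IsBoundedRV.add_const {S : Type*} [MeasurableSpace S] {g : S → ℝ} (hg : IsBoundedRV g)
    (a : ℝ) : IsBoundedRV fun s => g s + a := by
  obtain ⟨hm, C, hC⟩ := hg
  exact ⟨hm.add_const a, C + |a|, fun s => (abs_add_le _ _).trans (by gcongr; exact hC s)⟩

namespace IsExpectation

variable {S : Type*} [MeasurableSpace S] {E E' : (S → ℝ) → ℝ}

theorem lowerBound (hE : IsExpectation E) {Y : S → ℝ} {C : ℝ} (hY : ∀ s, |Y s| ≤ C) :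
    -C ∈ lowerBounds (E '' {g | IsBoundedRV g ∧ ∀ s, Y s ≤ g s}) := by
  rintro _ ⟨g, ⟨hg, hle⟩, rfl⟩
  rw [← hE.const (-C)]
  exact hE.mono _ _ (isBoundedRV_const _) hg fun s => (neg_le_of_abs_le (hY s)).trans (hle s)

theorem outerExpect_le (hE : IsExpectation E) {Y : S → ℝ} {C : ℝ} (hY : ∀ s, |Y s| ≤ C)
    {g : S → ℝ} (hg : IsBoundedRV g) (hle : ∀ s, Y s ≤ g s) : outerExpect E Y ≤ E g :=
  csInf_le ⟨_, hE.lowerBound hY⟩ ⟨g, ⟨hg, hle⟩, rfl⟩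

theorem le_outerExpect {Y : S → ℝ} {C b : ℝ} (hY : ∀ s, |Y s| ≤ C)
    (h : ∀ g, IsBoundedRV g → (∀ s, Y s ≤ g s) → b ≤ E g) : b ≤ outerExpect E Y := by
  refine le_csInf ⟨_, fun _ => C, ⟨isBoundedRV_const C, fun s => le_of_abs_le (hY s)⟩, rfl⟩ ?_
  rintro _ ⟨g, ⟨hg, hle⟩, rfl⟩
  exact h g hg hle

theorem abs_outerExpect_le (hE : IsExpectation E) {Y : S → ℝ} {C : ℝ} (hY : ∀ s, |Y s| ≤ C) :
    |outerExpect E Y| ≤ C := by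
  refine abs_le.mpr ⟨le_outerExpect hY fun g hg hle => ?_, ?_⟩
  · exact hE.lowerBound hY ⟨g, ⟨hg, hle⟩, rfl⟩
  · exact (hE.outerExpect_le hY (isBoundedRV_const C) fun s => le_of_abs_le (hY s)).trans_eq
      (hE.const C)

theorem outerExpect_le_add (hE : IsExpectation E) {Y Y' : S → ℝ} {C C' δ : ℝ}
    (hY : ∀ s, |Y s| ≤ C) (hY' : ∀ s, |Y' s| ≤ C') (h : ∀ s, Y s ≤ Y' s + δ) :
    outerExpect E Y ≤ outerExpect E Y' + δ := by
  rw [← sub_le_iff_le_add]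
  refine le_outerExpect hY' fun g hg hle => ?_
  rw [sub_le_iff_le_add, ← hE.add_const g δ hg]
  exact hE.outerExpect_le hY (hg.add_const δ) fun s => (h s).trans (by gcongr; exact hle s)

/-- Closeness is available only for functions bounded by `C`, while a majorant of `Y` can be larger.
Truncating it at `C` keeps it above `Y` and does not increase its expectation. -/
theorem outerExpect_le_of_close (hE : IsExpectation E) (hE' : IsExpectation E') {Y : S → ℝ}
    {C δ : ℝ} (hY : ∀ s, |Y s| ≤ C)
    (h : ∀ g, IsBoundedRV g → (∀ s, |g s| ≤ C) → E g ≤ E' g + δ) :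
    outerExpect E Y ≤ outerExpect E' Y + δ := by
  rw [← sub_le_iff_le_add]
  refine le_outerExpect hY fun g hg hle => ?_
  rw [sub_le_iff_le_add]
  have hb : ∀ s, |min (g s) C| ≤ C := fun s =>
    abs_le.mpr ⟨le_min ((neg_le_of_abs_le (hY s)).trans (hle s))
      ((neg_le_of_abs_le (hY s)).trans (le_of_abs_le (hY s))), min_le_right _ _⟩
  have hg' : IsBoundedRV fun s => min (g s) C := ⟨hg.1.min measurable_const, C, hb⟩
  calc outerExpect E Y ≤ E fun s => min (g s) C :=
        hE.outerExpect_le hY hg' fun s => le_min (hle s) (le_of_abs_le (hY s))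
    _ ≤ E' (fun s => min (g s) C) + δ := h _ hg' hb
    _ ≤ E' g + δ := by
        gcongr
        exact hE'.mono _ _ hg' hg fun s => min_le_left _ _

end IsExpectation

/-! ### The Bellman operator -/

section Bellman

variable {X U S H : Type*} [Fintype H] [DecidableEq H]
  {c : X → U → S → ℝ} {F : X → U → S → X} {γ : ℝ} {ϖ : Matrix H H ℝ}

theorem abs_bellman_integrand_le {Cc CV : ℝ} (hcb : ∀ x u s, |c x u s| ≤ Cc) (hγ : 0 ≤ γ)
    (hϖ : ϖ ∈ Matrix.rowStochastic ℝ H) {V : X × H → ℝ} (hV : ∀ z, |V z| ≤ CV)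
    (x : X) (e : H) (u : U) (s : S) :
    |c x u s + γ * ∑ e', ϖ e e' * V (F x u s, e')| ≤ Cc + γ * CV := by
  refine (abs_add_le _ _).trans (add_le_add (hcb x u s) ?_)
  rw [abs_mul, abs_of_nonneg hγ]
  refine mul_le_mul_of_nonneg_left ?_ hγ
  calc |∑ e', ϖ e e' * V (F x u s, e')| ≤ ∑ e', |ϖ e e' * V (F x u s, e')| :=
        Finset.abs_sum_le_sum_abs _ _
    _ ≤ ∑ e', ϖ e e' * CV := Finset.sum_le_sum fun e' _ => by
        rw [abs_mul, abs_of_nonneg (hϖ.1 e e')]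
        exact mul_le_mul_of_nonneg_left (hV _) (hϖ.1 e e')
    _ = CV := by
        rw [← Finset.sum_mul, Matrix.sum_row_of_mem_rowStochastic hϖ, one_mul]

/-- The bound on `a` matters: the real infimum of a family unbounded below is `0` by convention. -/
theorem ciInf_le_ciInf_add {U : Type*} [Nonempty U] {a b : U → ℝ} {δ C : ℝ}
    (ha : ∀ u, |a u| ≤ C) (h : ∀ u, a u ≤ b u + δ) : ⨅ u, a u ≤ (⨅ u, b u) + δ := by
  rw [← sub_le_iff_le_add]
  refine le_ciInf fun u => ?_
  rw [sub_le_iff_le_add]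
  exact (ciInf_le ⟨-C, by rintro _ ⟨v, rfl⟩; exact neg_le_of_abs_le (ha v)⟩ u).trans (h u)

variable [MeasurableSpace S] {E E' : H → (S → ℝ) → ℝ}

theorem abs_bellman_le [Nonempty U] {Cc CV : ℝ} (hcb : ∀ x u s, |c x u s| ≤ Cc) (hγ : 0 ≤ γ)
    (hϖ : ϖ ∈ Matrix.rowStochastic ℝ H) (hE : ∀ e, IsExpectation (E e)) {V : X × H → ℝ}
    (hV : ∀ z, |V z| ≤ CV) (z : X × H) : |bellman c F γ ϖ E V z| ≤ Cc + γ * CV := by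
  have h := fun u => abs_le.mp ((hE z.2).abs_outerExpect_le
    (abs_bellman_integrand_le (F := F) hcb hγ hϖ hV z.1 z.2 u))
  obtain ⟨u⟩ := ‹Nonempty U›
  refine abs_le.mpr ⟨@le_ciInf _ _ _ ⟨u⟩ _ _ fun u => (h u).1,
    (ciInf_le ⟨-(Cc + γ * CV), ?_⟩ u).trans (h u).2⟩
  rintro _ ⟨v, rfl⟩
  exact (h v).1

/-- Blackwell's discounting condition: the rows of `ϖ` sum to one, so a shift by `δ` passes through
the average over contexts and then through the outer expectation, picking up the factor `γ`. -/
theorem bellman_le_bellman_add [Nonempty U] {Cc CV CW δ : ℝ} (hcb : ∀ x u s, |c x u s| ≤ Cc)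
    (hγ : 0 ≤ γ) (hϖ : ϖ ∈ Matrix.rowStochastic ℝ H) (hE : ∀ e, IsExpectation (E e))
    {V W : X × H → ℝ} (hV : ∀ z, |V z| ≤ CV) (hW : ∀ z, |W z| ≤ CW) (h : ∀ z, V z ≤ W z + δ)
    (z : X × H) : bellman c F γ ϖ E V z ≤ bellman c F γ ϖ E W z + γ * δ := by
  refine ciInf_le_ciInf_add (fun u => (hE z.2).abs_outerExpect_le
    (abs_bellman_integrand_le hcb hγ hϖ hV z.1 z.2 u)) fun u => ?_
  refine (hE z.2).outerExpect_le_add (abs_bellman_integrand_le hcb hγ hϖ hV z.1 z.2 u)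
    (abs_bellman_integrand_le hcb hγ hϖ hW z.1 z.2 u) fun s => ?_
  rw [add_assoc, ← mul_add]
  gcongr
  calc ∑ e', ϖ z.2 e' * V (F z.1 u s, e')
      ≤ ∑ e', (ϖ z.2 e' * W (F z.1 u s, e') + ϖ z.2 e' * δ) := Finset.sum_le_sum fun e' _ => by
        rw [← mul_add]
        exact mul_le_mul_of_nonneg_left (h _) (hϖ.1 _ _)
    _ = _ := by
        rw [Finset.sum_add_distrib, ← Finset.sum_mul, Matrix.sum_row_of_mem_rowStochastic hϖ,
          one_mul]

theorem bellman_le_bellman_of_close [Nonempty U] {Cc CV δ : ℝ} (hcb : ∀ x u s, |c x u s| ≤ Cc)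
    (hγ : 0 ≤ γ) (hϖ : ϖ ∈ Matrix.rowStochastic ℝ H) (hE : ∀ e, IsExpectation (E e))
    (hE' : ∀ e, IsExpectation (E' e)) {V : X × H → ℝ} (hV : ∀ z, |V z| ≤ CV)
    (h : ∀ e g, IsBoundedRV g → (∀ s, |g s| ≤ Cc + γ * CV) → E e g ≤ E' e g + δ)
    (z : X × H) : bellman c F γ ϖ E V z ≤ bellman c F γ ϖ E' V z + δ :=
  ciInf_le_ciInf_add (fun u => (hE z.2).abs_outerExpect_le
    (abs_bellman_integrand_le hcb hγ hϖ hV z.1 z.2 u)) fun u =>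
    (hE z.2).outerExpect_le_of_close (hE' z.2) (abs_bellman_integrand_le hcb hγ hϖ hV z.1 z.2 u)
      (h z.2)

theorem abs_bellman_sub_le [Nonempty U] {Cc CV CW δ : ℝ} (hcb : ∀ x u s, |c x u s| ≤ Cc)
    (hγ : 0 ≤ γ) (hϖ : ϖ ∈ Matrix.rowStochastic ℝ H) (hE : ∀ e, IsExpectation (E e))
    {V W : X × H → ℝ} (hV : ∀ z, |V z| ≤ CV) (hW : ∀ z, |W z| ≤ CW)
    (h : ∀ z, |V z - W z| ≤ δ) (z : X × H) :
    |bellman c F γ ϖ E V z - bellman c F γ ϖ E W z| ≤ γ * δ := by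
  have h1 := bellman_le_bellman_add (F := F) hcb hγ hϖ hE hV hW (δ := δ)
    (fun z => by linarith [(abs_le.mp (h z)).2]) z
  have h2 := bellman_le_bellman_add (F := F) hcb hγ hϖ hE hW hV (δ := δ)
    (fun z => by linarith [(abs_le.mp (h z)).1]) z
  exact abs_le.mpr ⟨by linarith, by linarith⟩

/-- The Bellman equation has exactly one bounded solution. -/
theorem exists_isValueFunction [Nonempty U] (hcb : ∃ C : ℝ, ∀ x u s, |c x u s| ≤ C)
    (hγ : γ ∈ Set.Ioo (0 : ℝ) 1) (hϖ : ϖ ∈ Matrix.rowStochastic ℝ H)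
    (hE : ∀ e, IsExpectation (E e)) : ∃ V, IsValueFunction c F γ ϖ E V := by
  obtain ⟨Cc, hcb⟩ := hcb
  -- With the discrete topology, bounded continuous functions are all bounded functions, which
  -- provides the complete space for the fixed point theorem.
  let _ : TopologicalSpace (X × H) := ⊥
  have : DiscreteTopology (X × H) := ⟨rfl⟩
  let T : BoundedContinuousFunction (X × H) ℝ → BoundedContinuousFunction (X × H) ℝ := fun V =>
    BoundedContinuousFunction.ofNormedAddCommGroupDiscrete (bellman c F γ ϖ E V) (Cc + γ * ‖V‖)
      (abs_bellman_le hcb hγ.1.le hϖ hE V.norm_coe_le_norm)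
  have hT : ContractingWith ⟨γ, hγ.1.le⟩ T := by
    refine ⟨by exact_mod_cast hγ.2, LipschitzWith.of_dist_le_mul fun V W => ?_⟩
    refine (BoundedContinuousFunction.dist_le (mul_nonneg hγ.1.le dist_nonneg)).mpr fun z => ?_
    exact abs_bellman_sub_le hcb hγ.1.le hϖ hE V.norm_coe_le_norm W.norm_coe_le_norm
      (fun z => V.dist_coe_le_dist z) z
  refine ⟨hT.fixedPoint, ⟨⟨_, (hT.fixedPoint).norm_coe_le_norm⟩, fun z => ?_⟩, ?_⟩
  · exact (DFunLike.congr_fun hT.fixedPoint_isFixedPt z).symm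
  · rintro W ⟨⟨C, hC⟩, hW⟩
    let W' : BoundedContinuousFunction (X × H) ℝ :=
      BoundedContinuousFunction.ofNormedAddCommGroupDiscrete W C hC
    have : W' = hT.fixedPoint :=
      hT.fixedPoint_unique (BoundedContinuousFunction.ext fun z => (hW z).symm)
    rw [← this]
    rfl

/-- Stability of the value function under perturbations of the expectation. -/
theorem abs_valueFunction_sub_le [Nonempty U] {Cc CV δ : ℝ} (hcb : ∀ x u s, |c x u s| ≤ Cc)
    (hγ : γ ∈ Set.Ioo (0 : ℝ) 1) (hϖ : ϖ ∈ Matrix.rowStochastic ℝ H)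
    (hE : ∀ e, IsExpectation (E e)) (hE' : ∀ e, IsExpectation (E' e)) {V V' : X × H → ℝ}
    (hV : IsBellmanSolution c F γ ϖ E V) (hV' : IsBellmanSolution c F γ ϖ E' V')
    (hCV : ∀ z, |V z| ≤ CV)
    (h : ∀ e g, IsBoundedRV g → (∀ s, |g s| ≤ Cc + γ * CV) → |E' e g - E e g| ≤ δ)
    (z : X × H) : |V' z - V z| ≤ δ / (1 - γ) := by
  obtain ⟨⟨CV', hCV'⟩, hV'⟩ := hV'
  have hbdd : BddAbove (Set.range fun z => |V' z - V z|) := by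
    refine ⟨CV' + CV, ?_⟩
    rintro _ ⟨z, rfl⟩
    exact (abs_sub _ _).trans (add_le_add (hCV' z) (hCV z))
  -- Insert the operator of `E'` applied to `V`: one difference is a contraction for `E'`, the other
  -- changes only the expectation and involves only the bound on `V`.
  have key : ∀ z, |V' z - V z| ≤ γ * (⨆ z, |V' z - V z|) + δ := fun z => by
    have h1 := abs_bellman_sub_le (F := F) hcb hγ.1.le hϖ hE' hCV' hCV
      (fun z => le_ciSup hbdd z) z
    have h2 := bellman_le_bellman_of_close (F := F) hcb hγ.1.le hϖ hE hE' hCV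
      (δ := δ) (fun e g hg hgC => by linarith [(abs_le.mp (h e g hg hgC)).1]) z
    have h3 := bellman_le_bellman_of_close (F := F) hcb hγ.1.le hϖ hE' hE hCV
      (δ := δ) (fun e g hg hgC => by linarith [(abs_le.mp (h e g hg hgC)).2]) z
    rw [hV' z, hV.2 z]
    rw [abs_le] at h1 ⊢
    constructor <;> linarith
  have hsup : (⨆ z, |V' z - V z|) ≤ γ * (⨆ z, |V' z - V z|) + δ :=
    @ciSup_le _ _ _ ⟨z⟩ _ _ key
  rw [le_div_iff₀ (by linarith [hγ.2])]
  have := le_ciSup hbdd z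
  nlinarith [hγ.1, hγ.2]

end Bellman

/-! ### The context chain -/

section Chain

variable {H : Type*} [Fintype H] [DecidableEq H] {ϖ : Matrix H H ℝ}

/-- Some state carries mass, a power of `ϖ` moves part of it to `e`, and `ν` is invariant under that
power. -/
theorem IsStationary.pos {ν : H → ℝ} (hν : IsStationary ϖ ν) (hirr : ϖ.IsIrreducible) (e : H) :
    0 < ν e := by
  obtain ⟨h, hh⟩ : ∃ h, 0 < ν h := by
    by_contra! hle
    have := Finset.sum_nonpos fun h (_ : h ∈ Finset.univ) => hle h
    rw [hν.sum_eq_one] at this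
    exact absurd this (by norm_num)
  obtain ⟨k, -, hk⟩ := (Matrix.isIrreducible_iff_exists_pow_pos hirr.nonneg).mp hirr h e
  have hinv : ∀ k : ℕ, Matrix.vecMul ν (ϖ ^ k) = ν := fun k => by
    induction k with
    | zero => simp
    | succ k ih =>
      rw [pow_succ, ← Matrix.vecMul_vecMul, ih]
      exact funext fun h' => hν.invariant h'
  have hnn : ∀ h', 0 ≤ (ϖ ^ k) h' e := fun h' => by
    have := Matrix.pow_apply_nonneg hirr.nonneg k
    exact this h' e
  rw [← congrFun (hinv k) e]
  refine Finset.sum_pos' (fun h' _ => mul_nonneg (hν.nonneg h') (hnn h'))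
    ⟨h, Finset.mem_univ _, ?_⟩
  exact mul_pos hh hk

/-- A function witnessing geometric recurrence of the state `e`. -/
theorem exists_geometric_drift (hϖ : ϖ ∈ Matrix.rowStochastic ℝ H) (hirr : ϖ.IsIrreducible)
    (e : H) : ∃ (u : H → ℝ) (r s : ℝ), (r ∈ Set.Ioo (0 : ℝ) 1) ∧ (s ∈ Set.Ioo (0 : ℝ) 1) ∧
      (∀ h, 1 ≤ u h) ∧ ∀ h, (if h = e then s else 1) * ∑ h', ϖ h h' * u h' ≤ r * u h := by
  have hpow : ∀ k : ℕ, ϖ ^ k ∈ Matrix.rowStochastic ℝ H := fun k => pow_mem hϖ k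
  choose k hk0 hk using fun h => (Matrix.isIrreducible_iff_exists_pow_pos hirr.nonneg).mp hirr h e
  -- `G` adds up expected numbers of visits to `e` over the horizons `k h`, and `φ` collects the
  -- boundary terms of the telescoping sums. `φ` is positive at `h` because its summand with horizon
  -- `k h` is.
  let φ : H → ℝ := fun h' => ∑ h, (ϖ ^ k h) h' e
  let G : H → ℝ := fun h' => ∑ h, ∑ j ∈ Finset.range (k h), (ϖ ^ j) h' e
  have hφ : ∀ h, 0 < φ h := fun h =>
    Finset.sum_pos' (fun h' _ => (hpow (k h')).1 _ _) ⟨h, Finset.mem_univ _, hk h⟩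
  have hG : ∀ h, 0 ≤ G h := fun h =>
    Finset.sum_nonneg fun h' _ => Finset.sum_nonneg fun j _ => (hpow j).1 _ _
  have hstep : ∀ (j : ℕ) h, ∑ h', ϖ h h' * (ϖ ^ j) h' e = (ϖ ^ (j + 1)) h e := fun j h => by
    rw [pow_succ', Matrix.mul_apply]
  have hpoisson : ∀ h, ∑ h', ϖ h h' * G h' =
      G h - Fintype.card H * (if h = e then 1 else 0) + φ h := fun h => by
    have h1 : ∑ h', ϖ h h' * G h' = ∑ g, ∑ j ∈ Finset.range (k g), (ϖ ^ (j + 1)) h e := by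
      simp only [G, Finset.mul_sum]
      rw [Finset.sum_comm]
      refine Finset.sum_congr rfl fun g _ => ?_
      rw [Finset.sum_comm]
      exact Finset.sum_congr rfl fun j _ => hstep j h
    have h2 : ∀ g, ∑ j ∈ Finset.range (k g), (ϖ ^ (j + 1)) h e =
        (∑ j ∈ Finset.range (k g), (ϖ ^ j) h e) - (if h = e then 1 else 0) + (ϖ ^ k g) h e := by
      intro g
      have := Finset.sum_range_sub (fun j => (ϖ ^ j) h e) (k g)
      rw [Finset.sum_sub_distrib, pow_zero, Matrix.one_apply] at this
      linarith
    rw [h1, Finset.sum_congr rfl fun g _ => h2 g, Finset.sum_add_distrib, Finset.sum_sub_distrib]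
    simp [G, φ]
  obtain ⟨δ, hδ0, hδ1, hδ⟩ : ∃ δ : ℝ, 0 < δ ∧ δ < 1 ∧ ∀ h, δ ≤ φ h := by
    have : Nonempty H := ⟨e⟩
    obtain ⟨h₀, hh₀⟩ := Finite.exists_min φ
    exact ⟨min (φ h₀) (1 / 2), lt_min (hφ _) (by norm_num),
      (min_le_right _ _).trans_lt (by norm_num), fun h => (min_le_left _ _).trans (hh₀ h)⟩
  -- This makes `B - G` take values in `[1, B]`. Away from `e` one step lowers it by at least `δ`,
  -- hence by the factor `1 - δ / B`.
  set B : ℝ := 1 + ∑ h, G h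
  have hGB : ∀ h, G h ≤ B - 1 := fun h => by
    have := Finset.single_le_sum (fun h' _ => hG h') (Finset.mem_univ h)
    simpa [B] using this
  have hB : 1 ≤ B := by linarith [hGB e, hG e]
  have hr0 : 0 < 1 - δ / B := by
    rw [sub_pos, div_lt_one (by linarith)]
    linarith
  have hcard : (0 : ℝ) < Fintype.card H := by
    have : Nonempty H := ⟨e⟩
    exact_mod_cast Fintype.card_pos
  -- At `e` a step can raise the function by up to `Fintype.card H`; as the function is at least
  -- `1`, the growth factor is at most `r + Fintype.card H`, and `s = r / (r + Fintype.card H)`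
  -- brings it back to `r`.
  refine ⟨fun h => B - G h, 1 - δ / B, (1 - δ / B) / (1 - δ / B + Fintype.card H),
    ⟨hr0, by linarith [div_pos hδ0 (by linarith : 0 < B)]⟩, ⟨by positivity, ?_⟩,
    fun h => by linarith [hGB h], fun h => ?_⟩
  · rw [div_lt_one (by linarith)]
    linarith
  have hu : ∑ h', ϖ h h' * (B - G h') ≤
      (1 - δ / B) * (B - G h) + Fintype.card H * (if h = e then 1 else 0) := by
    simp only [mul_sub, Finset.sum_sub_distrib]
    rw [← Finset.sum_mul, Matrix.sum_row_of_mem_rowStochastic hϖ, hpoisson h]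
    have : δ / B * (B - G h) ≤ δ := by
      rw [div_mul_eq_mul_div, div_le_iff₀ (by linarith)]
      nlinarith [hG h]
    nlinarith [hδ h]
  split_ifs with he
  · rw [div_mul_eq_mul_div, div_le_iff₀ (by linarith)]
    rw [if_pos he] at hu
    have h1 : 1 ≤ B - G h := by linarith [hGB h]
    have h2 : ∑ h', ϖ h h' * (B - G h') ≤ (B - G h) * (1 - δ / B + Fintype.card H) := by
      nlinarith
    calc _ ≤ (1 - δ / B) * ((B - G h) * (1 - δ / B + Fintype.card H)) := by gcongr
      _ = _ := by ring
  · simpa [he] using hu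

end Chain

namespace IsDataProcess

variable {Ω S H : Type*} [MeasurableSpace Ω] [MeasureSpace S] [MeasurableSpace H]
  [DecidableEq H] {P : Measure Ω} {ϖ : Matrix H H ℝ} {q : S → H → ℝ} {η₁ : H}
  {ξ : ℕ → Ω → S} {η : ℕ → Ω → H}

/-- The finite-dimensional distributions of the contexts. -/
theorem measure_path (hd : IsDataProcess P ϖ q η₁ ξ η) (hq : ∀ e, IsDensity fun s => q s e)
    (N : ℕ) (h : ℕ → H) : P {ω | ∀ i ≤ N, η i ω = h i} =
      ENNReal.ofReal ((if h 0 = η₁ then 1 else 0) * ∏ i ∈ Finset.range N, ϖ (h i) (h (i + 1))) := by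
  have := hd.law N h (fun _ => Set.univ) fun _ => MeasurableSet.univ
  simpa [(hq _).integral_eq_one] using this

theorem measure_path_succ [Fintype H] (hd : IsDataProcess P ϖ q η₁ ξ η)
    (hq : ∀ e, IsDensity fun s => q s e) (hϖ : ϖ ∈ Matrix.rowStochastic ℝ H) (N : ℕ)
    (h : ℕ → H) : P {ω | ∀ i ≤ N + 1, η i ω = h i} =
      P {ω | ∀ i ≤ N, η i ω = h i} * ENNReal.ofReal (ϖ (h N) (h (N + 1))) := by
  rw [hd.measure_path hq, hd.measure_path hq, ← ENNReal.ofReal_mul,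
    Finset.prod_range_succ, mul_assoc]
  exact mul_nonneg (by split_ifs <;> simp) (Finset.prod_nonneg fun i _ => hϖ.1 _ _)

variable [Fintype H] [MeasurableSingletonClass H]

/-- The Markov property of the contexts. -/
theorem lintegral_markov (hd : IsDataProcess P ϖ q η₁ ξ η) (hq : ∀ e, IsDensity fun s => q s e)
    (hϖ : ϖ ∈ Matrix.rowStochastic ℝ H) (N : ℕ) (φ : (ℕ → H) → ENNReal)
    (hφ : ∀ h h' : ℕ → H, (∀ i ≤ N, h i = h' i) → φ h = φ h') (ψ : H → ENNReal) :
    ∫⁻ ω, φ (fun i => η i ω) * ψ (η (N + 1) ω) ∂P =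
      ∫⁻ ω, φ (fun i => η i ω) * ∑ h', ENNReal.ofReal (ϖ (η N ω) h') * ψ h' ∂P := by
  -- A finite history is extended by its last value. Since `φ` sees only times up to `N`, both sides
  -- become finite sums over histories, to be compared atom by atom.
  let ext : (Fin (N + 1) → H) → ℕ → H := fun t i => t ⟨min i N, by omega⟩
  let Z : Ω → Fin (N + 1) → H := fun ω i => η i ω
  have hZ : Measurable Z := measurable_pi_lambda _ fun i => hd.measurable_η i
  have hext : ∀ ω, φ (fun i => η i ω) = φ (ext (Z ω)) := fun ω =>
    hφ _ _ fun i hi => by simp [ext, Z, hi]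
  have hpath : ∀ t, Z ⁻¹' {t} = {ω | ∀ i ≤ N, η i ω = ext t i} := fun t => by
    ext ω
    simp only [Set.mem_preimage, Set.mem_singleton_iff, Set.mem_ofPred_eq]
    refine ⟨fun h i hi => by simp [← h, ext, Z, hi], fun h => funext fun i => ?_⟩
    have := h i (by omega)
    simpa [ext, Z, show min (i : ℕ) N = i by omega] using this
  have hpath' : ∀ t h', (fun ω => (Z ω, η (N + 1) ω)) ⁻¹' {(t, h')} =
      {ω | ∀ i ≤ N + 1, η i ω = if i ≤ N then ext t i else h'} := fun t h' => by
    ext ω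
    have h1 : Z ω = t ↔ ∀ i ≤ N, η i ω = ext t i := by
      simpa using Set.ext_iff.mp (hpath t) ω
    simp only [Set.mem_preimage, Set.mem_singleton_iff, Set.mem_ofPred_eq, Prod.mk.injEq, h1]
    constructor
    · rintro ⟨h2, h3⟩ i hi
      split_ifs with hiN
      · exact h2 i hiN
      · rw [show i = N + 1 by omega, h3]
    · intro h2
      refine ⟨fun i hi => by simpa [hi] using h2 i (by omega), by simpa using h2 (N + 1) le_rfl⟩
  have hl : ∫⁻ ω, φ (fun i => η i ω) * ψ (η (N + 1) ω) ∂P =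
      ∫⁻ x, φ (ext x.1) * ψ x.2 ∂(P.map fun ω => (Z ω, η (N + 1) ω)) := by
    rw [lintegral_map (measurable_of_countable _) (hZ.prodMk (hd.measurable_η _))]
    simp [hext]
  have hr : ∫⁻ ω, φ (fun i => η i ω) * ∑ h', ENNReal.ofReal (ϖ (η N ω) h') * ψ h' ∂P =
      ∫⁻ t, φ (ext t) * ∑ h', ENNReal.ofReal (ϖ (ext t N) h') * ψ h' ∂(P.map Z) := by
    rw [lintegral_map (measurable_of_countable _) hZ]
    simp only [hext]
    simp [ext, Z]
  rw [hl, hr, lintegral_fintype, lintegral_fintype, Fintype.sum_prod_type]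
  refine Finset.sum_congr rfl fun t _ => ?_
  rw [Finset.mul_sum, Finset.sum_mul]
  refine Finset.sum_congr rfl fun h' _ => ?_
  rw [Measure.map_apply (hZ.prodMk (hd.measurable_η _)) (measurableSet_singleton _),
    Measure.map_apply hZ (measurableSet_singleton _), hpath', hpath, hd.measure_path_succ hq hϖ]
  have : {ω | ∀ i ≤ N, η i ω = if i ≤ N then ext t i else h'} =
      {ω | ∀ i ≤ N, η i ω = ext t i} := by
    ext ω
    exact forall₂_congr fun i hi => by simp [hi]
  rw [this]
  simp only [le_refl, if_true, show ¬ N + 1 ≤ N by omega, if_false]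
  ring

/-- Almost surely the chain makes only transitions of positive probability. -/
theorem ae_transition_pos (hd : IsDataProcess P ϖ q η₁ ξ η) (hq : ∀ e, IsDensity fun s => q s e)
    (hϖ : ϖ ∈ Matrix.rowStochastic ℝ H) :
    ∀ᵐ ω ∂P, ∀ i, 0 < ϖ (η i ω) (η (i + 1) ω) := by
  rw [ae_all_iff]
  intro N
  have hm : Measurable fun ω => (η N ω, η (N + 1) ω) :=
    (hd.measurable_η N).prodMk (hd.measurable_η _)
  have hz : ∀ a h', ϖ a h' = 0 →
      P {ω | η N ω = a ∧ η (N + 1) ω = h'} = 0 := fun a h' h0 => by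
    have hA : MeasurableSet {ω | η N ω = a ∧ η (N + 1) ω = h'} :=
      (hd.measurable_η N (measurableSet_singleton a)).inter
        (hd.measurable_η (N + 1) (measurableSet_singleton h'))
    have := hd.lintegral_markov hq hϖ N (fun h => if h N = a then 1 else 0)
      (fun g g' hg => by rw [hg N le_rfl]) (fun g => if g = h' then 1 else 0)
    rw [← lintegral_indicator_one hA]
    calc _ = ∫⁻ ω, (if η N ω = a then 1 else 0) * (if η (N + 1) ω = h' then 1 else 0) ∂P := by
          refine lintegral_congr fun ω => ?_
          by_cases h1 : η N ω = a <;> by_cases h2 : η (N + 1) ω = h' <;>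
            simp [Set.indicator, h1, h2]
      _ = 0 := by
          rw [this]
          refine (lintegral_congr fun ω => ?_).trans lintegral_zero
          by_cases h1 : η N ω = a <;> simp [h1, h0]
  have : ∀ᵐ ω ∂P, ∀ a h', ϖ a h' = 0 → ¬ (η N ω = a ∧ η (N + 1) ω = h') := by
    simp only [ae_all_iff]
    intro a h' h0
    rw [ae_iff]
    simpa using hz a h' h0
  filter_upwards [this] with ω hω
  exact (hϖ.1 _ _).lt_of_ne fun h0 => hω _ _ h0.symm ⟨rfl, rfl⟩

/-- The probability of few visits to `e` decays geometrically. -/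
theorem lintegral_pow_count_le [IsProbabilityMeasure P] (hd : IsDataProcess P ϖ q η₁ ξ η)
    (hq : ∀ e, IsDensity fun s => q s e)
    (hϖ : ϖ ∈ Matrix.rowStochastic ℝ H) {e : H} {u : H → ℝ} {r s B : ℝ} (hr : 0 ≤ r)
    (hs : 0 ≤ s) (hu : ∀ h, 1 ≤ u h) (huB : ∀ h, u h ≤ B)
    (hdrift : ∀ h, (if h = e then s else 1) * ∑ h', ϖ h h' * u h' ≤ r * u h) (N : ℕ) :
    ∫⁻ ω, ENNReal.ofReal (s ^ Nat.count (fun i => η i ω = e) N) *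
      ENNReal.ofReal (u (η N ω)) ∂P ≤ ENNReal.ofReal (r ^ N * B) := by
  induction N with
  | zero =>
    calc _ ≤ ∫⁻ _, ENNReal.ofReal B ∂P := by
          refine lintegral_mono fun ω => ?_
          simpa using ENNReal.ofReal_le_ofReal (huB _)
      _ = _ := by simp
  | succ N ih =>
    -- The count up to `N + 1` involves only times at most `N`, so `u (η (N + 1))` can be averaged
    -- given the past. The visit at time `N` supplies the factor `s` or `1` of the drift inequality.
    have := hd.lintegral_markov hq hϖ N
      (fun h => ENNReal.ofReal (s ^ Nat.count (fun i => h i = e) (N + 1))) (fun h h' hh => by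
        simp only [Nat.count_eq_card_filter_range]
        congr 3
        exact Finset.filter_congr fun i hi => by rw [hh i (by simpa [Nat.lt_succ_iff] using hi)])
      fun h => ENNReal.ofReal (u h)
    rw [this]
    calc _ ≤ ∫⁻ ω, ENNReal.ofReal r * (ENNReal.ofReal (s ^ Nat.count (fun i => η i ω = e) N) *
          ENNReal.ofReal (u (η N ω))) ∂P := by
          refine lintegral_mono fun ω => ?_
          have hu0 : ∀ h, 0 ≤ u h := fun h => zero_le_one.trans (hu h)
          have h1 : ∑ h', ENNReal.ofReal (ϖ (η N ω) h') * ENNReal.ofReal (u h') =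
              ENNReal.ofReal (∑ h', ϖ (η N ω) h' * u h') := by
            rw [ENNReal.ofReal_sum_of_nonneg fun h' _ => mul_nonneg (hϖ.1 _ _) (hu0 _)]
            exact Finset.sum_congr rfl fun h' _ => (ENNReal.ofReal_mul (hϖ.1 _ _)).symm
          simp only
          rw [h1, ← ENNReal.ofReal_mul (by positivity), ← ENNReal.ofReal_mul (by positivity),
            ← ENNReal.ofReal_mul hr]
          refine ENNReal.ofReal_le_ofReal ?_
          have h2 : s ^ Nat.count (fun i => η i ω = e) (N + 1) =
              s ^ Nat.count (fun i => η i ω = e) N * (if η N ω = e then s else 1) := by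
            rw [Nat.count_succ]
            split_ifs <;> simp [pow_succ]
          rw [h2, mul_assoc, mul_left_comm r]
          exact mul_le_mul_of_nonneg_left (hdrift _) (by positivity)
      _ = ENNReal.ofReal r * ∫⁻ ω, ENNReal.ofReal (s ^ Nat.count (fun i => η i ω = e) N) *
          ENNReal.ofReal (u (η N ω)) ∂P := lintegral_const_mul' _ _ ENNReal.ofReal_ne_top
      _ ≤ ENNReal.ofReal r * ENNReal.ofReal (r ^ N * B) := by gcongr
      _ = _ := by rw [← ENNReal.ofReal_mul hr, pow_succ']; ring_nf

/-- Almost surely every context is visited with positive lower frequency. -/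
theorem ae_eventually_le_count [IsProbabilityMeasure P] (hd : IsDataProcess P ϖ q η₁ ξ η)
    (hq : ∀ e, IsDensity fun s => q s e) (hϖ : ϖ ∈ Matrix.rowStochastic ℝ H)
    (hirr : ϖ.IsIrreducible) (e : H) : ∃ b : ℝ, 0 < b ∧ ∀ᵐ ω ∂P, ∀ᶠ N : ℕ in atTop,
      b * N ≤ Nat.count (fun i => η i ω = e) N := by
  obtain ⟨u, r, s, hr, hs, hu, hdrift⟩ := exists_geometric_drift hϖ hirr e
  obtain ⟨B, hB⟩ : ∃ B, ∀ h, u h ≤ B := by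
    obtain ⟨B, hB⟩ := (Set.finite_range u).bddAbove
    exact ⟨B, fun h => hB ⟨h, rfl⟩⟩
  have hls : Real.log s < 0 := Real.log_neg hs.1 hs.2
  have hlr : Real.log r < 0 := Real.log_neg hr.1 hr.2
  -- Chosen so that `s ^ b = √r`. Fewer than `b * N` visits force the weight above `√r ^ N`, while
  -- its mean is at most `r ^ N * B`; Markov's inequality leaves the summable bound `√r ^ N * B`.
  set b := Real.log r / (2 * Real.log s) with hb
  have hsb : s ^ b = √r := by
    rw [Real.sqrt_eq_rpow, Real.rpow_def_of_pos hs.1, Real.rpow_def_of_pos hr.1, hb]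
    congr 1
    have := hls.ne
    field_simp
  have hr1 : 0 < √r := Real.sqrt_pos.mpr hr.1
  refine ⟨b, div_pos_of_neg_of_neg hlr (by linarith), ?_⟩
  have hbound : ∀ N : ℕ, P {ω | ¬ b * N ≤ Nat.count (fun i => η i ω = e) N} ≤
      ENNReal.ofReal (√r ^ N * B) := fun N => by
    have hsub : {ω | ¬ b * N ≤ Nat.count (fun i => η i ω = e) N} ⊆
        {ω | ENNReal.ofReal (√r ^ N) ≤ ENNReal.ofReal (s ^ Nat.count (fun i => η i ω = e) N) *
          ENNReal.ofReal (u (η N ω))} := fun ω hω => by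
      simp only [Set.mem_ofPred_eq, not_le] at hω ⊢
      rw [← ENNReal.ofReal_mul (pow_nonneg hs.1.le _)]
      refine ENNReal.ofReal_le_ofReal ?_
      calc √r ^ N = s ^ (b * N) := by rw [← hsb, Real.rpow_mul hs.1.le, Real.rpow_natCast]
        _ ≤ s ^ ((Nat.count (fun i => η i ω = e) N : ℕ) : ℝ) :=
          Real.rpow_le_rpow_of_exponent_ge hs.1 hs.2.le hω.le
        _ = s ^ Nat.count (fun i => η i ω = e) N * 1 := by rw [Real.rpow_natCast, mul_one]
        _ ≤ _ := mul_le_mul_of_nonneg_left (hu _) (pow_nonneg hs.1.le _)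
    refine (measure_mono hsub).trans ?_
    have hpos : ENNReal.ofReal (√r ^ N) ≠ 0 :=
      (ENNReal.ofReal_pos.mpr (pow_pos hr1 N)).ne'
    have hcm : Measurable fun ω => Nat.count (fun i => η i ω = e) N := by
      simp only [Nat.count_eq_card_filter_range, Finset.card_filter]
      exact Finset.measurable_sum _ fun i _ => Measurable.ite
        (hd.measurable_η i (measurableSet_singleton e)) measurable_const measurable_const
    refine (meas_ge_le_lintegral_div ?_ hpos ENNReal.ofReal_ne_top).trans ?_
    · exact (((measurable_of_countable fun n : ℕ => ENNReal.ofReal (s ^ n)).comp hcm).mul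
        ((measurable_of_countable fun h => ENNReal.ofReal (u h)).comp
          (hd.measurable_η N))).aemeasurable
    refine (ENNReal.div_le_div_right (hd.lintegral_pow_count_le hq hϖ hr.1.le hs.1.le hu hB
      hdrift N) _).trans_eq ?_
    rw [← ENNReal.ofReal_div_of_pos (pow_pos hr1 N)]
    congr 1
    rw [div_eq_iff (pow_pos hr1 N).ne']
    calc r ^ N * B = (√r * √r) ^ N * B := by rw [Real.mul_self_sqrt hr.1.le]
      _ = _ := by rw [mul_pow]; ring
  have hsum : ∑' N, P {ω | ¬ b * N ≤ Nat.count (fun i => η i ω = e) N} ≠ ⊤ := by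
    refine ne_top_of_le_ne_top ?_ (ENNReal.tsum_le_tsum hbound)
    have hsm : Summable fun N : ℕ => √r ^ N * B :=
      (summable_geometric_of_lt_one hr1.le
        ((Real.sqrt_lt' one_pos).mpr (by simpa using hr.2))).mul_right B
    exact hsm.tsum_ofReal_ne_top
  filter_upwards [ae_eventually_notMem hsum] with ω hω
  simpa using hω

end IsDataProcess

/-! ### Coupling with independent arrays and the law of large numbers -/

section DensityMeasure

variable {S H : Type*} [MeasureSpace S]

/-- The probability measure with density `q (· | e)`. -/
noncomputable def densityMeasure (q : S → H → ℝ) (e : H) : Measure S :=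
  volume.withDensity fun s => ENNReal.ofReal (q s e)

theorem densityMeasure_apply {q : S → H → ℝ} (hq : ∀ e, IsDensity fun s => q s e) (e : H)
    {A : Set S} (hA : MeasurableSet A) :
    densityMeasure q e A = ENNReal.ofReal (∫ s in A, q s e) := by
  rw [densityMeasure, withDensity_apply _ hA, ofReal_integral_eq_lintegral_ofReal
    (hq e).integrable.integrableOn (Eventually.of_forall (hq e).nonneg)]

theorem isProbabilityMeasure_densityMeasure {q : S → H → ℝ}
    (hq : ∀ e, IsDensity fun s => q s e) (e : H) : IsProbabilityMeasure (densityMeasure q e) :=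
  ⟨by rw [densityMeasure_apply hq e MeasurableSet.univ, setIntegral_univ, (hq e).integral_eq_one,
    ENNReal.ofReal_one]⟩

theorem integrable_densityMeasure_iff {q : S → H → ℝ} (hq : ∀ e, IsDensity fun s => q s e)
    {e : H} {φ : S → ℝ} :
    Integrable φ (densityMeasure q e) ↔ Integrable fun s => q s e * φ s := by
  rw [densityMeasure, integrable_withDensity_iff_integrable_smul'
    (hq e).measurable.ennreal_ofReal (Eventually.of_forall fun s => ENNReal.ofReal_lt_top)]
  simp only [ENNReal.toReal_ofReal ((hq e).nonneg _), smul_eq_mul]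

theorem integral_densityMeasure {q : S → H → ℝ} (hq : ∀ e, IsDensity fun s => q s e) (e : H)
    (φ : S → ℝ) : ∫ s, φ s ∂densityMeasure q e = ∫ s, q s e * φ s := by
  rw [densityMeasure, integral_withDensity_eq_integral_toReal_smul
    (hq e).measurable.ennreal_ofReal (Eventually.of_forall fun s => ENNReal.ofReal_lt_top)]
  simp only [ENNReal.toReal_ofReal ((hq e).nonneg _), smul_eq_mul]

end DensityMeasure

section Coupling

variable {S H : Type*} [MeasurableSpace S]

/-- Read off the observations from a context path and an array of values for all contexts. -/
def readArray (w : (ℕ → H) × (ℕ × H → S)) (i : ℕ) : S × H :=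
  (w.2 (i, w.1 i), w.1 i)

theorem measurable_readArray [MeasurableSpace H] [Countable H] [MeasurableSingletonClass H] :
    Measurable (readArray : (ℕ → H) × (ℕ × H → S) → ℕ → S × H) := by
  refine measurable_pi_lambda _ fun i => ?_
  have h1 : Measurable fun w : (ℕ → H) × (ℕ × H → S) => w.1 i :=
    (measurable_pi_apply i).comp measurable_fst
  refine Measurable.prodMk ?_ h1
  have h2 : Measurable fun v : H × (ℕ × H → S) => v.2 (i, v.1) :=
    measurable_from_prod_countable_right fun e => measurable_pi_apply (i, e)
  exact h2.comp (h1.prodMk measurable_snd)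

/-- Cylinders fixing all contexts up to some time. -/
def pathCylinders (S H : Type*) [MeasurableSpace S] : Set (Set (ℕ → S × H)) :=
  {C | ∃ (N : ℕ) (h : ℕ → H) (A : ℕ → Set S), (∀ i, MeasurableSet (A i)) ∧
    C = {z | ∀ i ≤ N, (z i).2 = h i ∧ (z i).1 ∈ A i}}

theorem measurableSet_pathCylinder [MeasurableSpace H] [MeasurableSingletonClass H] (N : ℕ)
    (h : ℕ → H) {A : ℕ → Set S} (hA : ∀ i, MeasurableSet (A i)) :
    MeasurableSet {z : ℕ → S × H | ∀ i ≤ N, (z i).2 = h i ∧ (z i).1 ∈ A i} := by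
  have : {z : ℕ → S × H | ∀ i ≤ N, (z i).2 = h i ∧ (z i).1 ∈ A i} =
      ⋂ i, ⋂ _ : i ≤ N, (fun z : ℕ → S × H => z i) ⁻¹' (A i ×ˢ {h i}) := by
    ext z
    simp [Set.mem_iInter, and_comm]
  rw [this]
  exact MeasurableSet.iInter fun i => MeasurableSet.iInter fun _ =>
    measurable_pi_apply i ((hA i).prod (measurableSet_singleton _))

/-- Two cylinders that meet prescribe the same contexts up to the shorter horizon, so their
intersection is again a cylinder with the longer horizon. -/
theorem isPiSystem_pathCylinders : IsPiSystem (pathCylinders S H) := by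
  have key : ∀ (N N' : ℕ) (h h' : ℕ → H) (A A' : ℕ → Set S), (∀ i, MeasurableSet (A i)) →
      (∀ i, MeasurableSet (A' i)) → N ≤ N' →
      ({z : ℕ → S × H | ∀ i ≤ N, (z i).2 = h i ∧ (z i).1 ∈ A i} ∩
        {z | ∀ i ≤ N', (z i).2 = h' i ∧ (z i).1 ∈ A' i}).Nonempty →
      {z : ℕ → S × H | ∀ i ≤ N, (z i).2 = h i ∧ (z i).1 ∈ A i} ∩
        {z | ∀ i ≤ N', (z i).2 = h' i ∧ (z i).1 ∈ A' i} ∈ pathCylinders S H := by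
    rintro N N' h h' A A' hA hA' hN ⟨z, hz, hz'⟩
    have hh : ∀ i ≤ N, h i = h' i := fun i hi =>
      (hz i hi).1.symm.trans (hz' i (hi.trans hN)).1
    refine ⟨N', h', fun i => if i ≤ N then A i ∩ A' i else A' i, fun i => ?_, ?_⟩
    · dsimp only
      split_ifs
      exacts [(hA i).inter (hA' i), hA' i]
    · ext w
      constructor
      · rintro ⟨h1, h2⟩ i hi
        refine ⟨(h2 i hi).1, ?_⟩
        dsimp only
        split_ifs with hiN
        exacts [⟨(h1 i hiN).2, (h2 i hi).2⟩, (h2 i hi).2]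
      · intro h1
        refine ⟨fun i hi => ?_, fun i hi => ⟨(h1 i hi).1, ?_⟩⟩
        · have := h1 i (hi.trans hN)
          simp only [if_pos hi] at this
          exact ⟨this.1.trans (hh i hi).symm, this.2.1⟩
        · have := (h1 i hi).2
          dsimp only at this
          split_ifs at this
          exacts [this.2, this]
  rintro _ ⟨N, h, A, hA, rfl⟩ _ ⟨N', h', A', hA', rfl⟩ hne
  rcases le_total N N' with hN | hN
  · exact key N N' h h' A A' hA hA' hN hne
  · rw [Set.inter_comm] at hne ⊢
    exact key N' N h' h A' A hA' hA hN hne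

theorem generateFrom_pathCylinders [MeasurableSpace H] [Finite H] [MeasurableSingletonClass H] :
    (MeasurableSpace.pi : MeasurableSpace (ℕ → S × H)) =
      MeasurableSpace.generateFrom (pathCylinders S H) := by
  refine le_antisymm ?_ (MeasurableSpace.generateFrom_le ?_)
  · refine iSup_le fun i => ?_
    rw [← measurable_iff_comap_le]
    have hrect : ∀ (e : H) (A : Set S), MeasurableSet A →
        MeasurableSet[MeasurableSpace.generateFrom (pathCylinders S H)]
          {z : ℕ → S × H | (z i).2 = e ∧ (z i).1 ∈ A} := fun e A hA => by
      -- A condition at the single time `i` becomes a finite union of cylinders by listing all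
      -- context histories before `i`.
      have heq : {z : ℕ → S × H | (z i).2 = e ∧ (z i).1 ∈ A} =
          ⋃ t : Fin (i + 1) → H, {z | ∀ j ≤ i,
            (z j).2 = (if j = i then e else t ⟨min j i, by omega⟩) ∧
            (z j).1 ∈ if j = i then A else Set.univ} := by
        ext z
        simp only [Set.mem_ofPred_eq, Set.mem_iUnion]
        constructor
        · intro hz
          refine ⟨fun j => (z j).2, fun j hj => ?_⟩
          by_cases hji : j = i
          · subst hji
            simpa using hz
          · simp [hji, hj]
        · rintro ⟨t, ht⟩
          simpa using ht i le_rfl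
      rw [heq]
      refine MeasurableSet.iUnion fun t => MeasurableSpace.measurableSet_generateFrom
        ⟨i, _, fun j => if j = i then A else Set.univ, fun j => ?_, rfl⟩
      dsimp only
      split_ifs
      exacts [hA, MeasurableSet.univ]
    intro B hB
    have heq : (fun z : ℕ → S × H => z i) ⁻¹' B =
        ⋃ e : H, {z | (z i).2 = e ∧ (z i).1 ∈ (fun s => (s, e)) ⁻¹' B} := by
      ext z
      simp
    rw [heq]
    exact MeasurableSet.iUnion fun e => hrect e _ (measurable_prodMk_right hB)
  · rintro _ ⟨N, h, A, hA, rfl⟩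
    exact measurableSet_pathCylinder N h hA

end Coupling

theorem IsDataProcess.measurable_data {Ω S H : Type*} [MeasurableSpace Ω] [MeasureSpace S]
    [MeasurableSpace H] [DecidableEq H] {P : Measure Ω} {ϖ : Matrix H H ℝ} {q : S → H → ℝ}
    {η₁ : H} {ξ : ℕ → Ω → S} {η : ℕ → Ω → H} (hd : IsDataProcess P ϖ q η₁ ξ η) :
    Measurable fun ω i => (ξ i ω, η i ω) :=
  measurable_pi_lambda _ fun i => (hd.measurable_ξ i).prodMk (hd.measurable_η i)

/-- The data have the law of the values of independent arrays read off along the contexts. -/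
theorem IsDataProcess.map_data_eq {Ω S H : Type*} [MeasurableSpace Ω] [MeasureSpace S]
    [MeasurableSpace H] [DecidableEq H] [Fintype H] [MeasurableSingletonClass H]
    {P : Measure Ω} [IsProbabilityMeasure P] {ϖ : Matrix H H ℝ} {q : S → H → ℝ} {η₁ : H}
    {ξ : ℕ → Ω → S} {η : ℕ → Ω → H} (hd : IsDataProcess P ϖ q η₁ ξ η)
    (hq : ∀ e, IsDensity fun s => q s e) (hϖ : ϖ ∈ Matrix.rowStochastic ℝ H)
    [∀ e, IsProbabilityMeasure (densityMeasure q e)] :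
    P.map (fun ω i => (ξ i ω, η i ω)) =
      ((P.map fun ω i => η i ω).prod
        (Measure.infinitePi fun x : ℕ × H => densityMeasure q x.2)).map readArray := by
  have hη : Measurable fun ω i => η i ω := measurable_pi_lambda _ hd.measurable_η
  have : IsProbabilityMeasure (P.map fun ω i => η i ω) :=
    Measure.isProbabilityMeasure_map hη.aemeasurable
  have h1 : IsProbabilityMeasure (P.map fun ω i => (ξ i ω, η i ω)) :=
    Measure.isProbabilityMeasure_map hd.measurable_data.aemeasurable
  have h2 : IsProbabilityMeasure (((P.map fun ω i => η i ω).prod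
      (Measure.infinitePi fun x : ℕ × H => densityMeasure q x.2)).map readArray) :=
    Measure.isProbabilityMeasure_map measurable_readArray.aemeasurable
  refine ext_of_generate_finite _ generateFrom_pathCylinders isPiSystem_pathCylinders ?_
    (by rw [measure_univ, measure_univ])
  rintro _ ⟨N, h, A, hA, rfl⟩
  have hC := measurableSet_pathCylinder N h hA
  rw [Measure.map_apply hd.measurable_data hC, Measure.map_apply measurable_readArray hC]
  -- Once the contexts are fixed, the values are read at the cells `(i, h i)`, which are distinct
  -- for distinct times; the preimage is a rectangle and its measure factors.
  have hpre : (readArray ⁻¹' {z : ℕ → S × H | ∀ i ≤ N, (z i).2 = h i ∧ (z i).1 ∈ A i}) =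
      {g : ℕ → H | ∀ i ≤ N, g i = h i} ×ˢ
        (((Finset.range (N + 1)).map
          ⟨fun i => (i, h i), fun i j hij => (Prod.mk.inj hij).1⟩ : Finset (ℕ × H)) :
            Set (ℕ × H)).pi fun x => A x.1 := by
    ext w
    simp only [Set.mem_preimage, readArray, Set.mem_ofPred_eq, Set.mem_prod, Set.mem_pi,
      Finset.coe_map, Set.mem_image, Finset.mem_coe, Finset.mem_range, Nat.lt_succ_iff,
      forall_exists_index, and_imp, forall_apply_eq_imp_iff₂]
    constructor
    · exact fun hw => ⟨fun i hi => (hw i hi).1, fun i hi => by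
        have := (hw i hi).2
        rwa [(hw i hi).1] at this⟩
    · exact fun hw i hi => ⟨hw.1 i hi, by
        rw [hw.1 i hi]
        exact hw.2 i hi⟩
  have hpath : MeasurableSet {g : ℕ → H | ∀ i ≤ N, g i = h i} := by
    have : {g : ℕ → H | ∀ i ≤ N, g i = h i} =
        ⋂ i, ⋂ _ : i ≤ N, (fun g : ℕ → H => g i) ⁻¹' {h i} := by
      ext g
      simp
    rw [this]
    exact MeasurableSet.iInter fun i => MeasurableSet.iInter fun _ =>
      measurable_pi_apply i (measurableSet_singleton _)
  rw [hpre, Measure.prod_prod, Measure.infinitePi_pi _ (fun x _ => hA x.1), Finset.prod_map,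
    Measure.map_apply hη hpath]
  simp only [Set.preimage_ofPred_eq]
  rw [hd.measure_path hq, hd.law N h A hA, ENNReal.ofReal_mul, ENNReal.ofReal_prod_of_nonneg]
  · simp only [densityMeasure_apply hq _ (hA _)]
    rfl
  · exact fun i _ => integral_nonneg fun s => (hq _).nonneg s
  · exact mul_nonneg (by split_ifs <;> simp) (Finset.prod_nonneg fun i _ => hϖ.1 _ _)

theorem sum_ite_eq_sum_nth {E : Type*} [AddCommMonoid E] (p : ℕ → Prop) [DecidablePred p]
    (a : ℕ → E) (N : ℕ) : (∑ i ∈ Finset.range N, if p i then a i else 0) =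
      ∑ j ∈ Finset.range (Nat.count p N), a (Nat.nth p j) := by
  induction N with
  | zero => simp
  | succ N ih =>
    rw [Finset.sum_range_succ, ih, Nat.count_succ]
    split_ifs with h
    · rw [Finset.sum_range_succ, Nat.nth_count h]
    · simp

section StrongLaw

variable {S H E : Type*} [MeasurableSpace S] [DecidableEq H] [NormedAddCommGroup E]
  [NormedSpace ℝ E] [CompleteSpace E] [MeasurableSpace E] [BorelSpace E]

/-- The strong law of large numbers for one column of an array, along given times. -/
theorem ae_tendsto_average_column (Q : H → Measure S) [∀ e, IsProbabilityMeasure (Q e)]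
    {G : S → E} (hG : Measurable G) (e : H) (hint : Integrable G (Q e))
    (hmean : ∫ s, G s ∂Q e = 0) (h : ℕ → H) :
    ∀ᵐ ζ ∂(Measure.infinitePi fun x : ℕ × H => Q x.2), Tendsto (fun N : ℕ => (N : ℝ)⁻¹ •
      ∑ i ∈ Finset.range N, if h i = e then G (ζ (i, e)) else 0) atTop (𝓝 0) := by
  set π := Measure.infinitePi fun x : ℕ × H => Q x.2
  -- With infinitely many visits, the values at successive visit times are i.i.d. and the classical
  -- strong law applies. With finitely many, the sum is eventually constant.
  by_cases hinf : (Set.ofPred fun i => h i = e).Infinite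
  · let X : ℕ → (ℕ × H → S) → E := fun j ζ => G (ζ (Nat.nth (fun i => h i = e) j, e))
    have hmap : ∀ i, π.map (fun ζ => ζ (i, e)) = Q e := fun i =>
      Measure.infinitePi_map_eval (fun x : ℕ × H => Q x.2) (i, e)
    have hXmap : ∀ j, π.map (X j) = (Q e).map G := fun j => by
      rw [← hmap (Nat.nth (fun i => h i = e) j), Measure.map_map hG (measurable_pi_apply _)]
      rfl
    have hXm : ∀ j, Measurable (X j) := fun j => hG.comp (measurable_pi_apply _)
    have hX0 : Integrable (X 0) π := by
      have : Integrable G (π.map fun ζ => ζ (Nat.nth (fun i => h i = e) 0, e)) := by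
        rwa [hmap]
      exact this.comp_measurable (measurable_pi_apply _)
    have hXint : ∫ ζ, X 0 ζ ∂π = 0 := by
      rw [← hmean, ← hmap (Nat.nth (fun i => h i = e) 0), integral_map
        (measurable_pi_apply _).aemeasurable (by rw [hmap]; exact hint.aestronglyMeasurable)]
    have hindep : Pairwise (Function.onFun (fun f g => ProbabilityTheory.IndepFun f g π) X) := by
      intro j j' hj
      have hall := ProbabilityTheory.iIndepFun_infinitePi (P := fun x : ℕ × H => Q x.2)
        (X := fun _ => G) fun _ => hG
      refine hall.indepFun (i := (Nat.nth (fun i => h i = e) j, e))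
        (j := (Nat.nth (fun i => h i = e) j', e)) fun heq => hj ?_
      exact (Nat.nth_strictMono hinf).injective (Prod.mk.inj heq).1
    have hslln := ProbabilityTheory.strong_law_ae X hX0 hindep fun j =>
      ⟨(hXm j).aemeasurable, (hXm 0).aemeasurable, by rw [hXmap, hXmap]⟩
    have hcount : Tendsto (Nat.count fun i => h i = e) atTop atTop := by
      refine tendsto_atTop_atTop_of_monotone (Nat.count_monotone _) fun b => ?_
      exact ⟨Nat.nth (fun i => h i = e) b, (Nat.count_nth_of_infinite hinf b).ge⟩
    filter_upwards [hslln] with ζ hζ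
    rw [hXint] at hζ
    have hnorm := (hζ.comp hcount).norm
    rw [norm_zero] at hnorm
    -- Dividing by `N` instead of by the number of visits only decreases the norm, so no limiting
    -- frequency is needed.
    refine squeeze_zero_norm (fun N => ?_) hnorm
    rw [sum_ite_eq_sum_nth]
    simp only [Function.comp, norm_smul, norm_inv, Real.norm_natCast]
    rcases Nat.eq_zero_or_pos (Nat.count (fun i => h i = e) N) with h0 | h0
    · simp [h0]
    · gcongr
      exact Nat.count_le _
  · have hfin : (Set.ofPred fun i => h i = e).Finite := Set.not_infinite.mp hinf
    obtain ⟨M, hM⟩ := hfin.bddAbove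
    refine Eventually.of_forall fun ζ => ?_
    have hconst : ∀ N ≥ M + 1, (∑ i ∈ Finset.range N, if h i = e then G (ζ (i, e)) else 0) =
        ∑ i ∈ Finset.range (M + 1), if h i = e then G (ζ (i, e)) else 0 := fun N hN =>
      Finset.eventually_constant_sum (fun n hn => if_neg fun hne => by
        have : n ≤ M := hM hne
        omega) hN
    have hlim := (tendsto_inv_atTop_nhds_zero_nat (𝕜 := ℝ)).smul_const
      (∑ i ∈ Finset.range (M + 1), if h i = e then G (ζ (i, e)) else 0)
    rw [zero_smul] at hlim
    refine hlim.congr' ?_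
    filter_upwards [eventually_ge_atTop (M + 1)] with N hN
    rw [hconst N hN]

end StrongLaw

/-- The strong law of large numbers for the data, for functions with values in a Banach space. -/
theorem IsDataProcess.ae_tendsto_average {Ω S H E : Type*} [MeasurableSpace Ω] [MeasureSpace S]
    [MeasurableSpace H] [DecidableEq H] [Fintype H] [MeasurableSingletonClass H]
    [NormedAddCommGroup E] [NormedSpace ℝ E] [CompleteSpace E] [MeasurableSpace E] [BorelSpace E]
    [SecondCountableTopology E]
    {P : Measure Ω} [IsProbabilityMeasure P] {ϖ : Matrix H H ℝ} {q : S → H → ℝ} {η₁ : H}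
    {ξ : ℕ → Ω → S} {η : ℕ → Ω → H} (hd : IsDataProcess P ϖ q η₁ ξ η)
    (hq : ∀ e, IsDensity fun s => q s e) (hϖ : ϖ ∈ Matrix.rowStochastic ℝ H)
    {g : S → H → E} (hg : ∀ e, Measurable fun s => g s e)
    (hint : ∀ e, Integrable (fun s => g s e) (densityMeasure q e)) :
    ∀ᵐ ω ∂P, Tendsto (fun N : ℕ => (N : ℝ)⁻¹ • ∑ i ∈ Finset.range N,
      (g (ξ i ω) (η i ω) - ∫ s, g s (η i ω) ∂densityMeasure q (η i ω))) atTop (𝓝 0) := by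
  have hprob := isProbabilityMeasure_densityMeasure hq
  let G : S × H → E := fun x => g x.1 x.2 - ∫ s, g s x.2 ∂densityMeasure q x.2
  have hG : Measurable G := measurable_from_prod_countable_left fun e =>
    (hg e).sub_const (∫ s, g s e ∂densityMeasure q e)
  let good : Set (ℕ → S × H) := {z | Tendsto (fun N : ℕ => (N : ℝ)⁻¹ •
    ∑ i ∈ Finset.range N, G (z i)) atTop (𝓝 0)}
  have hgood : MeasurableSet good := by
    refine measurableSet_tendsto_fun (fun N => ?_) measurable_const
    exact (Finset.measurable_sum _ fun i _ => hG.comp (measurable_pi_apply i)).const_smul _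
  have hη : Measurable fun ω i => η i ω := measurable_pi_lambda _ hd.measurable_η
  have hprod : ∀ᵐ w ∂((P.map fun ω i => η i ω).prod
      (Measure.infinitePi fun x : ℕ × H => densityMeasure q x.2)), readArray w ∈ good := by
    -- Fubini freezes the context path. The data then split into one column per context, each
    -- handled by the strong law along deterministic times.
    refine (Measure.ae_prod_iff_ae_ae (measurable_readArray hgood)).mpr
      (Eventually.of_forall fun h => ?_)
    have hcol := fun e => ae_tendsto_average_column (densityMeasure q) (hG.comp
      (measurable_prodMk_right (y := e))) e ((hint e).sub
      (integrable_const (∫ s, g s e ∂densityMeasure q e))) (by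
        simp only [Function.comp, G]
        rw [integral_sub (hint e) (integrable_const _)]
        simp) h
    filter_upwards [ae_all_iff.mpr hcol] with ζ hζ
    have hsum := tendsto_finsetSum Finset.univ fun e (_ : e ∈ Finset.univ) => hζ e
    rw [Finset.sum_const_zero] at hsum
    refine hsum.congr fun N => ?_
    rw [← Finset.smul_sum, Finset.sum_comm]
    congr 1
    refine Finset.sum_congr rfl fun i _ => ?_
    rw [Finset.sum_ite_eq]
    simp [readArray]
  have hmap := (ae_map_iff measurable_readArray.aemeasurable hgood).mpr hprod
  rw [← hd.map_data_eq hq hϖ] at hmap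
  exact ae_of_ae_map hd.measurable_data.aemeasurable hmap

/-- A family of continuous functions that depends measurably on a parameter, pointwise, does so
in the uniform norm. -/
theorem measurable_continuousMap_of_eval {S T : Type*} [MeasurableSpace S] [MetricSpace T]
    [CompactSpace T] [MeasurableSpace C(T, ℝ)] [BorelSpace C(T, ℝ)] {g : S → C(T, ℝ)}
    (hg : ∀ t, Measurable fun s => g s t) : Measurable g := by
  -- By continuity, the uniform distance is decided on a countable dense set of points of `T`.
  have hdist : ∀ a : C(T, ℝ), Measurable fun s => dist (g s) a := fun a => by
    refine measurable_of_Iic fun r => ?_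
    obtain ⟨D, hDc, hDd⟩ := TopologicalSpace.exists_countable_dense T
    by_cases hr : 0 ≤ r
    · have : (fun s => dist (g s) a) ⁻¹' Set.Iic r = ⋂ t ∈ D, {s | dist (g s t) (a t) ≤ r} := by
        ext s
        simp only [Set.mem_preimage, Set.mem_Iic, Set.mem_iInter, Set.mem_ofPred_eq]
        rw [ContinuousMap.dist_le hr]
        refine ⟨fun h t _ => h t, fun h t => ?_⟩
        have hcl : IsClosed {t | dist (g s t) (a t) ≤ r} :=
          isClosed_le ((g s).continuous.dist a.continuous) continuous_const
        exact hcl.closure_subset_iff.mpr (fun t ht => h t ht) (hDd t)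
      rw [this]
      exact MeasurableSet.biInter hDc fun t _ =>
        measurableSet_le ((hg t).dist measurable_const) measurable_const
    · convert MeasurableSet.empty
      ext s
      simpa using (not_le.mp hr).trans_le dist_nonneg
  refine measurable_of_isOpen fun O hO => ?_
  obtain ⟨D, hDc, hDd⟩ := TopologicalSpace.exists_countable_dense C(T, ℝ)
  -- `C(T, ℝ)` is separable, so an open set is a countable union of balls with centres in a dense
  -- sequence.
  have : g ⁻¹' O = ⋃ a ∈ D, ⋃ n : ℕ, ⋃ _ : Metric.ball a (1 / (n + 1)) ⊆ O,
      {s | dist (g s) a < 1 / (n + 1)} := by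
    ext s
    simp only [Set.mem_preimage, Set.mem_iUnion, Set.mem_ofPred_eq, exists_prop]
    constructor
    · intro hs
      obtain ⟨ε, hε, hball⟩ := Metric.isOpen_iff.mp hO _ hs
      obtain ⟨n, hn⟩ := exists_nat_one_div_lt (half_pos hε)
      obtain ⟨a, ha, had⟩ := hDd.exists_dist_lt (g s) (Nat.one_div_pos_of_nat (α := ℝ) (n := n))
      refine ⟨a, ha, n, fun b hb => hball ?_, had⟩
      have := dist_triangle b a (g s)
      rw [Metric.mem_ball] at hb ⊢
      rw [dist_comm] at had
      linarith
    · rintro ⟨a, _, n, hsub, hd⟩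
      exact hsub hd
  rw [this]
  exact MeasurableSet.biUnion hDc fun a _ => MeasurableSet.iUnion fun n =>
    MeasurableSet.iUnion fun _ => measurableSet_lt (hdist a) measurable_const

/-! ### Relative entropy and total variation -/

/-- A pointwise Pinsker inequality. In terms of square roots `x`, `y`, the bound `log z ≤ z - 1`
makes the entropy integrand at least `(x - y) ^ 2`, and `|x - y| * (x + y)` is split with weight
`t`. The terms `a - b` keep the integrand nonnegative and cancel on integration of densities. -/
theorem abs_sub_le_entropy {a b t : ℝ} (ha : 0 < a) (hb : 0 < b) (ht : 0 < t) :
    |a - b| ≤ (a - b - b * (Real.log a - Real.log b)) / (2 * t) + t * (a + b) := by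
  obtain ⟨x, hx, rfl⟩ : ∃ x : ℝ, 0 < x ∧ a = x ^ 2 :=
    ⟨√a, Real.sqrt_pos.mpr ha, (Real.sq_sqrt ha.le).symm⟩
  obtain ⟨y, hy, rfl⟩ : ∃ y : ℝ, 0 < y ∧ b = y ^ 2 :=
    ⟨√b, Real.sqrt_pos.mpr hb, (Real.sq_sqrt hb.le).symm⟩
  have hlog : y ^ 2 * (Real.log (x ^ 2) - Real.log (y ^ 2)) ≤ 2 * (x * y - y ^ 2) := by
    have h1 : Real.log x - Real.log y ≤ x / y - 1 := by
      rw [← Real.log_div hx.ne' hy.ne']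
      exact Real.log_le_sub_one_of_pos (div_pos hx hy)
    have h2 : y ^ 2 * (x / y - 1) = x * y - y ^ 2 := by field_simp
    rw [Real.log_pow, Real.log_pow]
    push_cast
    nlinarith [mul_le_mul_of_nonneg_left h1 (sq_nonneg y)]
  have hsq : (x - y) ^ 2 / (2 * t) ≤
      (x ^ 2 - y ^ 2 - y ^ 2 * (Real.log (x ^ 2) - Real.log (y ^ 2))) / (2 * t) := by
    gcongr
    nlinarith
  refine le_trans ?_ (add_le_add_left hsq _)
  have habs : |x ^ 2 - y ^ 2| = |x - y| * (x + y) := by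
    rw [sq_sub_sq, abs_mul, abs_of_pos (add_pos hx hy), mul_comm]
  rw [habs, div_add' _ _ _ (by positivity), le_div_iff₀ (by positivity)]
  nlinarith [sq_nonneg (|x - y| - t * (x + y)), sq_abs (x - y), sq_nonneg (t * (x - y))]

/-- The total variation distance is controlled by the relative entropy. -/
theorem IsDensity.abs_integral_sub_le {S : Type*} [MeasureSpace S] {a b : S → ℝ}
    (ha : IsDensity a) (hb : IsDensity b) (hapos : ∀ s, 0 < a s) (hbpos : ∀ s, 0 < b s)
    (hint : Integrable fun s => b s * (Real.log (a s) - Real.log (b s))) {Y : S → ℝ}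
    (hY : IsBoundedRV Y) {C : ℝ} (hC : ∀ s, |Y s| ≤ C) {t : ℝ} (ht : 0 < t) :
    |(∫ s, Y s * a s) - ∫ s, Y s * b s| ≤
      C * (-(∫ s, b s * (Real.log (a s) - Real.log (b s))) / (2 * t) + 2 * t) := by
  rw [← integral_sub (hY.integrable_mul ha.integrable) (hY.integrable_mul hb.integrable)]
  have hi1 := ha.integrable.sub hb.integrable
  have hi2 := (hi1.sub hint).div_const (2 * t)
  have hi3 := (ha.integrable.add hb.integrable).const_mul t
  rw [← Real.norm_eq_abs]
  refine (norm_integral_le_of_norm_le ((hi2.add hi3).const_mul C)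
    (Eventually.of_forall fun s => ?_)).trans_eq ?_
  · rw [← mul_sub, norm_mul]
    exact mul_le_mul (hC s) (abs_sub_le_entropy (hapos s) (hbpos s) ht) (norm_nonneg _)
      ((abs_nonneg _).trans (hC s))
  · rw [integral_const_mul]
    congr 1
    have e1 : ∫ s, ((fun x => (((a - b) - fun s => b s * (Real.log (a s) - Real.log (b s))) x) /
        (2 * t)) + fun x => t * (a + b) x) s =
        (∫ s, (((a - b) - fun s => b s * (Real.log (a s) - Real.log (b s))) s) / (2 * t)) +
          ∫ s, t * (a + b) s := integral_add hi2 hi3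
    rw [e1, integral_div, integral_sub' hi1 hint, integral_sub' ha.integrable hb.integrable,
      integral_const_mul, integral_add' ha.integrable hb.integrable, ha.integral_eq_one,
      hb.integral_eq_one]
    ring

/-! ### Posterior concentration -/

/-- Averages, for weights `L N` that decay exponentially with a rate comparable to `K`,
concentrate on the zeros of `K`. -/
theorem tendsto_weighted_average_zero {T : Type*} [MeasureSpace T] {p : T → ℝ} (hp : IsDensity p)
    {K : T → ℝ} (hKm : Measurable K) (hK0 : ∀ θ, 0 ≤ K θ) {M : ℝ} (hKM : ∀ θ, K θ ≤ M)
    (hmass : ∀ δ > 0, 0 < ∫ θ in {θ | K θ < δ}, p θ) {L : ℕ → T → ℝ}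
    (hL : ∀ N, IsBoundedRV (L N)) {c : ℕ → ℝ} (hc : ∀ N, 0 < c N) {b : ℝ} (hb : 0 < b)
    (hbound : ∀ ε > 0, ∀ᶠ N : ℕ in atTop, ∀ θ, c N * Real.exp (-(N * (K θ + ε))) ≤ L N θ ∧
      L N θ ≤ c N * Real.exp (-(N * (b * K θ - ε)))) :
    Tendsto (fun N => ∫ θ, K θ * (L N θ * p θ / ∫ θ', L N θ' * p θ')) atTop (𝓝 0) := by
  have hM : 0 ≤ M := by
    by_contra! h
    have : IsEmpty T := ⟨fun θ => absurd ((hK0 θ).trans (hKM θ)) (not_le.mpr h)⟩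
    have h1 := hp.integral_eq_one
    rw [Measure.eq_zero_of_isEmpty (volume : Measure T), integral_zero_measure] at h1
    exact zero_ne_one h1
  have hKb : IsBoundedRV K := ⟨hKm, M, fun θ => by
    rw [abs_of_nonneg (hK0 θ)]
    exact hKM θ⟩
  have key : ∀ δ > 0, ∃ m > 0, ∀ᶠ N : ℕ in atTop,
      0 ≤ ∫ θ, K θ * (L N θ * p θ / ∫ θ', L N θ' * p θ') ∧
      ∫ θ, K θ * (L N θ * p θ / ∫ θ', L N θ' * p θ') ≤
        δ + M / m * Real.exp (-(b * δ / 4)) ^ N := fun δ hδ => by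
    -- On `{K ≥ δ}` the weight is at most of order `exp(-N(bδ - ε))`, and the normalization is at
    -- least of order `exp(-2Nε)`. With `bδ = 4ε` the quotient is of order `exp(-Nε)`.
    set ε := b * δ / 4 with hε
    have hε0 : 0 < ε := by positivity
    set m := ∫ θ in {θ | K θ < ε}, p θ
    have hm : 0 < m := hmass ε hε0
    refine ⟨m, hm, ?_⟩
    filter_upwards [hbound ε hε0] with N hN
    have hLi := (hL N).integrable_mul hp.integrable
    have hL0 : ∀ θ, 0 ≤ L N θ := fun θ =>
      (mul_nonneg (hc N).le (Real.exp_pos _).le).trans (hN θ).1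
    have hZ : c N * Real.exp (-(N * (ε + ε))) * m ≤ ∫ θ, L N θ * p θ := by
      have hset : MeasurableSet {θ | K θ < ε} := measurableSet_lt hKm measurable_const
      calc c N * Real.exp (-(N * (ε + ε))) * m
          = ∫ θ in {θ | K θ < ε}, c N * Real.exp (-(N * (ε + ε))) * p θ :=
            (integral_const_mul _ _).symm
        _ ≤ ∫ θ in {θ | K θ < ε}, L N θ * p θ := by
            refine setIntegral_mono_on (hp.integrable.const_mul _).integrableOn
              hLi.integrableOn hset fun θ hθ => ?_
            refine mul_le_mul_of_nonneg_right (le_trans ?_ (hN θ).1) (hp.nonneg θ)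
            have hθ' : K θ < ε := hθ
            have := (hc N).le
            gcongr
        _ ≤ ∫ θ, L N θ * p θ := setIntegral_le_integral hLi
            (Eventually.of_forall fun θ => mul_nonneg (hL0 θ) (hp.nonneg θ))
    have hZ0 : 0 < ∫ θ, L N θ * p θ :=
      lt_of_lt_of_le (mul_pos (mul_pos (hc N) (Real.exp_pos _)) hm) hZ
    refine ⟨integral_nonneg fun θ => mul_nonneg (hK0 θ)
      (div_nonneg (mul_nonneg (hL0 θ) (hp.nonneg θ)) hZ0.le), ?_⟩
    have hnum : ∫ θ, K θ * (L N θ * p θ) ≤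
        δ * (∫ θ, L N θ * p θ) + M * (c N * Real.exp (-(N * (b * δ - ε)))) := by
      calc ∫ θ, K θ * (L N θ * p θ)
          ≤ ∫ θ, (δ * (L N θ * p θ) + M * (c N * Real.exp (-(N * (b * δ - ε)))) * p θ) := by
            refine integral_mono (hKb.integrable_mul hLi)
              ((hLi.const_mul δ).add (hp.integrable.const_mul _)) fun θ => ?_
            simp only
            rw [← mul_assoc, ← mul_assoc, ← add_mul]
            refine mul_le_mul_of_nonneg_right ?_ (hp.nonneg θ)
            have hc' := (hc N).le
            -- Where `K < δ` the factor `K` is small; elsewhere `K ≤ M` and the weight is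
            -- exponentially small.
            rcases lt_or_ge (K θ) δ with h | h
            · have h1 := mul_le_mul_of_nonneg_right h.le (hL0 θ)
              have h2 : 0 ≤ M * (c N * Real.exp (-(N * (b * δ - ε)))) := by positivity
              linarith
            · have h1 : L N θ ≤ c N * Real.exp (-(N * (b * δ - ε))) :=
                (hN θ).2.trans (by gcongr)
              have h2 := mul_le_mul (hKM θ) h1 (hL0 θ) hM
              have h3 := mul_nonneg hδ.le (hL0 θ)
              linarith
        _ = _ := by
            rw [integral_add (hLi.const_mul δ) (hp.integrable.const_mul _), integral_const_mul,
              integral_const_mul, hp.integral_eq_one, mul_one]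
    have heq : ∫ θ, K θ * (L N θ * p θ / ∫ θ', L N θ' * p θ') =
        (∫ θ, K θ * (L N θ * p θ)) / ∫ θ, L N θ * p θ := by
      rw [← integral_div]
      simp only [mul_div_assoc]
    rw [heq, div_le_iff₀ hZ0]
    refine hnum.trans ?_
    rw [add_mul]
    refine (add_le_add_iff_left _).mpr ?_
    calc M * (c N * Real.exp (-(N * (b * δ - ε))))
        = M / m * Real.exp (-ε) ^ N * (c N * Real.exp (-(N * (ε + ε))) * m) := by
          have hexp : Real.exp (-(N * (b * δ - ε))) =
              Real.exp (-ε) ^ N * Real.exp (-(N * (ε + ε))) := by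
            rw [← Real.exp_nat_mul, ← Real.exp_add]
            congr 1
            rw [hε]
            ring
          rw [hexp]
          field_simp
      _ ≤ _ := mul_le_mul_of_nonneg_left hZ (by positivity)
  rw [Metric.tendsto_nhds]
  intro ε hε
  obtain ⟨m, hm, hN⟩ := key (ε / 2) (half_pos hε)
  have hlim : Tendsto (fun N : ℕ => M / m * Real.exp (-(b * (ε / 2) / 4)) ^ N) atTop (𝓝 0) := by
    have := (tendsto_pow_atTop_nhds_zero_of_lt_one (Real.exp_pos _).le
      (Real.exp_lt_one_iff.mpr (show -(b * (ε / 2) / 4) < 0 by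
        have : 0 < b * (ε / 2) / 4 := by positivity
        linarith))).const_mul (M / m)
    simpa using this
  filter_upwards [hN, hlim.eventually_lt_const (half_pos hε)] with N h1 h2
  rw [Real.dist_eq, sub_zero, abs_of_nonneg h1.1]
  linarith [h1.2]

/-! ### True and predictive expectations as monotone, translation equivariant functionals -/

theorem isExpectation_condExpect {S H : Type*} [MeasureSpace S] {q : S → H → ℝ}
    (hq : ∀ e, IsDensity fun s => q s e) (e : H) : IsExpectation (condExpect q e) where
  mono g g' hg hg' hle := integral_mono (hg.integrable_mul (hq e).integrable)
    (hg'.integrable_mul (hq e).integrable)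
    fun s => mul_le_mul_of_nonneg_right (hle s) ((hq e).nonneg s)
  const a := by simp [condExpect, integral_const_mul, (hq e).integral_eq_one]
  add_const g a hg := by
    simp only [condExpect, add_mul]
    rw [integral_add (hg.integrable_mul (hq e).integrable) ((hq e).integrable.const_mul a),
      integral_const_mul, (hq e).integral_eq_one, mul_one]

theorem isExpectation_predictiveExpect {S H T : Type*} [MeasureSpace S] [MeasureSpace T]
    {f : S → H → T → ℝ} (hf : ∀ e θ, IsDensity fun s => f s e θ)
    (hin : ∀ e g, IsBoundedRV g → IsBoundedRV fun θ => ∫ s, g s * f s e θ) {pN : T → ℝ}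
    (hpN : IsDensity pN) (e : H) : IsExpectation (predictiveExpect f pN e) where
  mono g g' hg hg' hle := integral_mono ((hin e g hg).integrable_mul hpN.integrable)
    ((hin e g' hg').integrable_mul hpN.integrable) fun θ => mul_le_mul_of_nonneg_right
      ((isExpectation_condExpect (q := fun s e => f s e θ) (fun e => hf e θ) e).mono g g' hg hg'
        hle) (hpN.nonneg θ)
  const a := by
    simp [predictiveExpect, integral_const_mul, (hf e _).integral_eq_one, hpN.integral_eq_one]
  add_const g a hg := by
    have h1 : ∀ θ, ∫ s, (g s + a) * f s e θ = (∫ s, g s * f s e θ) + a := fun θ =>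
      (isExpectation_condExpect (q := fun s e => f s e θ) (fun e => hf e θ) e).add_const g a hg
    simp only [predictiveExpect, h1]
    simp only [add_mul]
    rw [integral_add ((hin e g hg).integrable_mul hpN.integrable) (hpN.integrable.const_mul a),
      integral_const_mul, hpN.integral_eq_one, mul_one]

/-- A nonempty relatively open subset that meets the interior has positive volume. -/
theorem volume_subtype_pos_of_mem_interior {k : ℕ} {Θ : Set (EuclideanSpace ℝ (Fin k))}
    (hΘ : MeasurableSet Θ) {A : Set Θ} (hA : IsOpen A) {θ : Θ} (hθA : θ ∈ A)
    (hθ : (θ : EuclideanSpace ℝ (Fin k)) ∈ interior Θ) : 0 < volume A := by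
  obtain ⟨O, hO, rfl⟩ := isOpen_induced_iff.mp hA
  have hpos : 0 < volume (O ∩ interior Θ) :=
    (hO.inter isOpen_interior).measure_pos _ ⟨θ, hθA, hθ⟩
  refine hpos.trans_le ?_
  have : (volume : Measure Θ) = Measure.comap Subtype.val volume := rfl
  rw [this, comap_subtype_coe_apply hΘ]
  exact measure_mono fun x hx => ⟨⟨x, interior_subset hx.2⟩, hx.1, rfl⟩

/-! ### Likelihood, entropy and posterior under the consistency assumptions -/

namespace ConsistencyAssumptions

variable {k : ℕ} {S H : Type*} [MeasureSpace S] [Fintype H] [DecidableEq H] [MeasurableSpace H]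
  {Θ : Set (EuclideanSpace ℝ (Fin k))} {p : Θ → ℝ} {f : S → H → Θ → ℝ} {q : S → H → ℝ}
  {ϖ : Matrix H H ℝ} {ν : H → ℝ}

/-- Continuity in `θ` and measurability in `s` make `f` jointly measurable (Carathéodory), so the
parameter integral is measurable. -/
theorem isBoundedRV_integral [SFinite (volume : Measure S)]
    (hA : ConsistencyAssumptions Θ p f q ϖ ν) (hf : ∀ e θ, IsDensity fun s => f s e θ) (e : H)
    {g : S → ℝ} (hg : IsBoundedRV g) : IsBoundedRV fun θ => ∫ s, g s * f s e θ := by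
  have hfm : Measurable (Function.uncurry fun θ s => f s e θ) :=
    measurable_uncurry_of_continuous_of_measurable (u := fun θ s => f s e θ)
      (fun s => hA.continuous s e) fun θ => (hf e θ).measurable
  obtain ⟨hgm, C, hC⟩ := hg
  refine ⟨?_, C, fun θ => ?_⟩
  · exact (StronglyMeasurable.integral_prod_right (ν := (volume : Measure S))
      (f := fun θ s => g s * f s e θ)
      ((hgm.comp measurable_snd).mul hfm).stronglyMeasurable).measurable
  · have hb : ∀ s, ‖g s * f s e θ‖ ≤ C * f s e θ := fun s => by
      rw [norm_mul, Real.norm_of_nonneg ((hf e θ).nonneg s)]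
      exact mul_le_mul_of_nonneg_right (hC s) ((hf e θ).nonneg s)
    calc ‖∫ s, g s * f s e θ‖ ≤ ∫ s, C * f s e θ :=
          norm_integral_le_of_norm_le ((hf e θ).integrable.const_mul C)
            (Eventually.of_forall hb)
      _ = C := by rw [integral_const_mul, (hf e θ).integral_eq_one, mul_one]

theorem likelihood_pos (hA : ConsistencyAssumptions Θ p f q ϖ ν) {y : ℕ → S} {h : ℕ → H}
    (hh : ∀ i, 0 < ϖ (h i) (h (i + 1))) (N : ℕ) (θ : Θ) : 0 < likelihood f ϖ y h N θ :=
  mul_pos (Finset.prod_pos fun _ _ => hA.pos _ _ _) (Finset.prod_pos fun _ _ => hh _)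

theorem continuous_likelihood (hA : ConsistencyAssumptions Θ p f q ϖ ν) (y : ℕ → S) (h : ℕ → H)
    (N : ℕ) : Continuous (likelihood f ϖ y h N) := by
  unfold likelihood
  exact (continuous_finsetProd _ fun i _ => hA.continuous _ _).mul continuous_const

theorem isBoundedRV_likelihood (hA : ConsistencyAssumptions Θ p f q ϖ ν) (y : ℕ → S)
    (h : ℕ → H) (N : ℕ) : IsBoundedRV (likelihood f ϖ y h N) := by
  have : CompactSpace Θ := isCompact_iff_compactSpace.mp hA.isCompact
  have hc := hA.continuous_likelihood y h N
  obtain ⟨C, hC⟩ := isCompact_univ.exists_bound_of_continuousOn hc.continuousOn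
  exact ⟨hc.measurable, C, fun θ => hC θ (Set.mem_univ _)⟩

theorem prior_pos (hA : ConsistencyAssumptions Θ p f q ϖ ν) (θ : Θ) : 0 < p θ := by
  obtain ⟨c₁, c₂, h0, h⟩ := hA.prior_bounds
  exact h0.trans_le (h θ).1

/-- The transition factors enter the likelihood, so their positivity along the path is what keeps
the normalizing integral away from zero. -/
theorem isDensity_posterior (hA : ConsistencyAssumptions Θ p f q ϖ ν) (hp : IsDensity p)
    {y : ℕ → S} {h : ℕ → H} (hh : ∀ i, 0 < ϖ (h i) (h (i + 1))) (N : ℕ) :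
    IsDensity (posterior f ϖ p y h N) := by
  have hLi := (hA.isBoundedRV_likelihood y h N).integrable_mul hp.integrable
  have hpos : ∀ θ, 0 < likelihood f ϖ y h N θ * p θ := fun θ =>
    mul_pos (hA.likelihood_pos hh N θ) (hA.prior_pos θ)
  have hne : (volume : Measure Θ) ≠ 0 := fun h0 => by
    have := hp.integral_eq_one
    rw [h0, integral_zero_measure] at this
    exact zero_ne_one this
  have hZ : 0 < ∫ θ, likelihood f ϖ y h N θ * p θ := by
    rw [integral_pos_iff_support_of_nonneg (fun θ => (hpos θ).le) hLi,
      show (Function.support fun θ => likelihood f ϖ y h N θ * p θ) = Set.univ from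
        Set.eq_univ_of_forall fun θ => (hpos θ).ne']
    exact Measure.measure_univ_pos.mpr hne
  refine ⟨?_, fun θ => div_nonneg (hpos θ).le hZ.le, hLi.div_const _, ?_⟩
  · exact ((hA.isBoundedRV_likelihood y h N).1.mul hp.measurable).div_const _
  · simp only [posterior]
    rw [integral_div, div_self hZ.ne']

/-- The log-likelihood ratio of a parameter and the reference parameter. -/
noncomputable def logRatio (hA : ConsistencyAssumptions Θ p f q ϖ ν) (θs : Θ) (s : S) (e : H) :
    C(Θ, ℝ) where
  toFun θ := Real.log (f s e θ) - Real.log (f s e θs)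
  continuous_toFun := ((hA.continuous s e).log fun θ => (hA.pos s e θ).ne').sub continuous_const

/-- The slice of the stationary law at `e` is `densityMeasure q e` scaled by `ν e`, which is
positive by irreducibility; integrability and null sets therefore descend to each context. -/
theorem exists_integrable_bound [MeasurableSingletonClass H]
    (hA : ConsistencyAssumptions Θ p f q ϖ ν) (hν : IsStationary ϖ ν) (e : H) :
    ∃ G : S → ℝ, Integrable G (densityMeasure q e) ∧
      ∀ᵐ s ∂densityMeasure q e, ∀ θ, |Real.log (f s e θ)| ≤ G s := by
  obtain ⟨G, hG, hdom⟩ := hA.dominated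
  have hm : Measurable fun s : S => (s, e) := measurable_prodMk_right
  have hle : ENNReal.ofReal (ν e) • (densityMeasure q e).map (fun s => (s, e)) ≤
      stationaryLaw ν q := by
    have := Finset.add_sum_erase Finset.univ (fun h => ENNReal.ofReal (ν h) •
      (densityMeasure q h).map fun s => (s, h)) (Finset.mem_univ e)
    exact (Measure.le_add_right le_rfl).trans this.le
  have hν0 : ENNReal.ofReal (ν e) ≠ 0 :=
    (ENNReal.ofReal_pos.mpr (hν.pos hA.irreducible e)).ne'
  refine ⟨fun s => G (s, e), ?_, ?_⟩
  · exact ((integrable_smul_measure hν0 ENNReal.ofReal_ne_top).mp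
      (hG.mono_measure hle)).comp_measurable hm
  · exact ae_of_ae_map hm.aemeasurable
      ((Measure.ae_ennreal_smul_measure_iff hν0).mp (ae_mono hle hdom))

variable [MeasurableSingletonClass H]

/-- The domination is uniform in `θ`, so it bounds the sup norm by `2 * G`. This gives Bochner
integrability in `C(Θ, ℝ)` and hence a strong law uniform in `θ`. -/
theorem integrable_logRatio (hA : ConsistencyAssumptions Θ p f q ϖ ν) (hν : IsStationary ϖ ν)
    (hf : ∀ e θ, IsDensity fun s => f s e θ) [CompactSpace Θ] [MeasurableSpace C(Θ, ℝ)]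
    [BorelSpace C(Θ, ℝ)] (θs : Θ) (e : H) :
    Measurable (fun s => hA.logRatio θs s e) ∧
      Integrable (fun s => hA.logRatio θs s e) (densityMeasure q e) := by
  have hm : Measurable fun s => hA.logRatio θs s e := measurable_continuousMap_of_eval fun θ =>
    (hf e θ).measurable.log.sub (hf e θs).measurable.log
  obtain ⟨G, hG, hdom⟩ := hA.exists_integrable_bound hν e
  refine ⟨hm, (hG.const_mul 2).mono' hm.aestronglyMeasurable ?_⟩
  filter_upwards [hdom] with s hs
  refine (ContinuousMap.norm_le _ (by linarith [(abs_nonneg _).trans (hs θs)])).mpr fun θ => ?_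
  refine (abs_sub _ _).trans ?_
  linarith [hs θ, hs θs]

end ConsistencyAssumptions

theorem sum_comp_eq_sum_count {H : Type*} [Fintype H] [DecidableEq H] (h : ℕ → H) (a : H → ℝ)
    (N : ℕ) : ∑ i ∈ Finset.range N, a (h i) = ∑ e, Nat.count (fun i => h i = e) N * a e := by
  calc ∑ i ∈ Finset.range N, a (h i)
      = ∑ i ∈ Finset.range N, ∑ e, if h i = e then a e else 0 := by simp
    _ = ∑ e, ∑ i ∈ Finset.range N, if h i = e then a e else 0 := Finset.sum_comm
    _ = _ := Finset.sum_congr rfl fun e _ => by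
        rw [← Finset.sum_filter, Finset.sum_const, nsmul_eq_mul, Nat.count_eq_card_filter_range]

theorem integrable_continuousMap_apply {S T : Type*} [MeasurableSpace S] [TopologicalSpace T]
    [CompactSpace T] {μ : Measure S} {g : S → C(T, ℝ)} (hg : Integrable g μ) (t : T) :
    Integrable (fun s => g s t) μ :=
  (ContinuousMap.evalCLM ℝ t).integrable_comp hg

namespace ConsistencyAssumptions

variable {k : ℕ} {S H : Type*} [MeasureSpace S] [Fintype H] [DecidableEq H] [MeasurableSpace H]
  {Θ : Set (EuclideanSpace ℝ (Fin k))} {p : Θ → ℝ} {f : S → H → Θ → ℝ} {q : S → H → ℝ}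
  {ϖ : Matrix H H ℝ} {ν : H → ℝ}

theorem logRatio_apply (hA : ConsistencyAssumptions Θ p f q ϖ ν) (θs : Θ) (s : S) (e : H)
    (θ : Θ) : hA.logRatio θs s e θ = Real.log (f s e θ) - Real.log (f s e θs) :=
  rfl

/-- The transition probabilities do not depend on the parameter, so the ratio of likelihoods
involves only the densities. -/
theorem likelihood_eq_mul_exp (hA : ConsistencyAssumptions Θ p f q ϖ ν) (θs : Θ) (y : ℕ → S)
    (h : ℕ → H) (N : ℕ) (θ : Θ) : likelihood f ϖ y h N θ = likelihood f ϖ y h N θs *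
      Real.exp (∑ i ∈ Finset.range N, hA.logRatio θs (y i) (h i) θ) := by
  rw [Real.exp_sum, likelihood, likelihood, mul_right_comm, ← Finset.prod_mul_distrib]
  congr 1
  refine Finset.prod_congr rfl fun i _ => ?_
  rw [hA.logRatio_apply, Real.exp_sub, Real.exp_log (hA.pos _ _ _), Real.exp_log (hA.pos _ _ _),
    mul_div_cancel₀ _ (hA.pos _ _ _).ne']

variable [CompactSpace Θ]

/-- The entropy of the reference density in context `e` relative to the parametric family. -/
noncomputable def entropy (hA : ConsistencyAssumptions Θ p f q ϖ ν) (θs : Θ) (e : H) : C(Θ, ℝ) :=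
  -∫ s, hA.logRatio θs s e ∂densityMeasure q e

/-- The sum of the entropies over all contexts. -/
noncomputable def totalEntropy (hA : ConsistencyAssumptions Θ p f q ϖ ν) (θs : Θ) : C(Θ, ℝ) :=
  ∑ e, hA.entropy θs e

variable [MeasurableSingletonClass H] [MeasurableSpace C(Θ, ℝ)] [BorelSpace C(Θ, ℝ)]

theorem abs_integral_sub_le_entropy (hA : ConsistencyAssumptions Θ p f q ϖ ν)
    (hν : IsStationary ϖ ν) (hf : ∀ e θ, IsDensity fun s => f s e θ)
    (hq : ∀ e, IsDensity fun s => q s e) {θs : Θ} (hspec : IsCorrectlySpecified f q θs) (e : H)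
    (θ : Θ) {g : S → ℝ} (hg : IsBoundedRV g) {C : ℝ} (hC : ∀ s, |g s| ≤ C) {t : ℝ}
    (ht : 0 < t) : |(∫ s, g s * f s e θ) - condExpect q e g| ≤
      C * (hA.entropy θs e θ / (2 * t) + 2 * t) := by
  have hqf : ∀ s, q s e = f s e θs := congrFun (hspec e)
  have hint := (hA.integrable_logRatio hν hf θs e).2
  have hev : Integrable (fun s => hA.logRatio θs s e θ) (densityMeasure q e) :=
    integrable_continuousMap_apply hint θ
  rw [integrable_densityMeasure_iff hq] at hev
  have hlr : ∀ s, q s e * hA.logRatio θs s e θ =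
      q s e * (Real.log (f s e θ) - Real.log (q s e)) := fun s => by
    rw [hA.logRatio_apply, hqf s]
  have hent : hA.entropy θs e θ =
      -∫ s, q s e * (Real.log (f s e θ) - Real.log (q s e)) := by
    rw [entropy, ContinuousMap.neg_apply, ContinuousMap.integral_apply hint,
      integral_densityMeasure hq]
    simp only [hlr]
  simp only [hlr] at hev
  rw [hent]
  have hqpos : ∀ s, 0 < q s e := fun s => by
    rw [hqf s]
    exact hA.pos s e θs
  exact (hf e θ).abs_integral_sub_le (hq e) (fun s => hA.pos s e θ) hqpos hev hg hC ht

/-- The total variation bound for the zero function already says that `entropy / (2 * t) + 2 * t` is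
nonnegative for every `t > 0`. A negative entropy contradicts this for small `t`; the choice below
gives `4 * t ^ 2 = -entropy / 4`. -/
theorem entropy_nonneg (hA : ConsistencyAssumptions Θ p f q ϖ ν)
    (hν : IsStationary ϖ ν) (hf : ∀ e θ, IsDensity fun s => f s e θ)
    (hq : ∀ e, IsDensity fun s => q s e) {θs : Θ} (hspec : IsCorrectlySpecified f q θs) (e : H)
    (θ : Θ) : 0 ≤ hA.entropy θs e θ := by
  by_contra! hneg
  set t := √(-hA.entropy θs e θ) / 4 with ht
  have hsq := Real.sq_sqrt (neg_nonneg.mpr hneg.le)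
  have ht0 : 0 < t := by
    have := Real.sqrt_pos.mpr (neg_pos.mpr hneg)
    positivity
  have := hA.abs_integral_sub_le_entropy hν hf hq hspec e θ (isBoundedRV_const 0)
    (C := 1) (fun s => by simp) ht0
  have h1 := (abs_nonneg _).trans this
  rw [one_mul, div_add' _ _ _ (by positivity)] at h1
  have h2 := mul_nonneg h1 (by positivity : 0 ≤ 2 * t)
  rw [div_mul_cancel₀ _ (by positivity)] at h2
  nlinarith

theorem entropy_self (hA : ConsistencyAssumptions Θ p f q ϖ ν)
    (hν : IsStationary ϖ ν) (hf : ∀ e θ, IsDensity fun s => f s e θ) (θs : Θ) (e : H) :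
    hA.entropy θs e θs = 0 := by
  rw [entropy, ContinuousMap.neg_apply,
    ContinuousMap.integral_apply (hA.integrable_logRatio hν hf θs e).2]
  simp [logRatio]

/-- Two-sided exponential bounds for the likelihood. -/
theorem eventually_likelihood_bounds (hA : ConsistencyAssumptions Θ p f q ϖ ν)
    (hν : IsStationary ϖ ν) (hf : ∀ e θ, IsDensity fun s => f s e θ)
    (hq : ∀ e, IsDensity fun s => q s e) {θs : Θ} (hspec : IsCorrectlySpecified f q θs)
    {y : ℕ → S} {h : ℕ → H} (hh : ∀ i, 0 < ϖ (h i) (h (i + 1))) {b : ℝ}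
    (hb : ∀ e, ∀ᶠ N : ℕ in atTop, b * N ≤ Nat.count (fun i => h i = e) N)
    (havg : Tendsto (fun N : ℕ => (N : ℝ)⁻¹ • ∑ i ∈ Finset.range N,
      (hA.logRatio θs (y i) (h i) - ∫ s, hA.logRatio θs s (h i) ∂densityMeasure q (h i)))
      atTop (𝓝 0)) {ε : ℝ} (hε : 0 < ε) : ∀ᶠ N : ℕ in atTop, ∀ θ,
      likelihood f ϖ y h N θs * Real.exp (-(N * (hA.totalEntropy θs θ + ε))) ≤
        likelihood f ϖ y h N θ ∧
      likelihood f ϖ y h N θ ≤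
        likelihood f ϖ y h N θs * Real.exp (-(N * (b * hA.totalEntropy θs θ - ε))) := by
  filter_upwards [eventually_all.mpr hb, (Metric.tendsto_nhds.mp havg) ε hε,
    eventually_gt_atTop 0] with N hcount hN hN0 θ
  have hN0' : (0 : ℝ) < N := by exact_mod_cast hN0
  have hent0 := fun e => hA.entropy_nonneg hν hf hq hspec e θ
  have hK : hA.totalEntropy θs θ = ∑ e, hA.entropy θs e θ := by
    simp [totalEntropy, ContinuousMap.sum_apply]
  -- Evaluation at `θ` is bounded by the sup norm, so one threshold for `N` serves all parameters.
  have hdev : |∑ i ∈ Finset.range N, hA.logRatio θs (y i) (h i) θ +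
      ∑ i ∈ Finset.range N, hA.entropy θs (h i) θ| ≤ N * ε := by
    rw [dist_zero_right, norm_smul, norm_inv, Real.norm_natCast,
      inv_mul_lt_iff₀ hN0'] at hN
    refine le_trans (le_of_eq ?_) ((ContinuousMap.norm_coe_le_norm _ θ).trans hN.le)
    rw [Real.norm_eq_abs, ContinuousMap.sum_apply, ← Finset.sum_add_distrib]
    refine congrArg abs (Finset.sum_congr rfl fun i _ => ?_)
    rw [entropy, ContinuousMap.neg_apply, ContinuousMap.sub_apply, sub_eq_add_neg]
  -- Entropies are nonnegative, so the visit counts can be replaced by their bounds: at most `N`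
  -- here and at least `b * N` in the next estimate.
  have hup : ∑ i ∈ Finset.range N, hA.entropy θs (h i) θ ≤ N * hA.totalEntropy θs θ := by
    rw [sum_comp_eq_sum_count h (fun e => hA.entropy θs e θ), hK, Finset.mul_sum]
    refine Finset.sum_le_sum fun e _ => mul_le_mul_of_nonneg_right ?_ (hent0 e)
    exact_mod_cast Nat.count_le _
  have hlow : N * (b * hA.totalEntropy θs θ) ≤
      ∑ i ∈ Finset.range N, hA.entropy θs (h i) θ := by
    rw [sum_comp_eq_sum_count h (fun e => hA.entropy θs e θ), hK, ← mul_assoc, Finset.mul_sum]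
    refine Finset.sum_le_sum fun e _ => mul_le_mul_of_nonneg_right ?_ (hent0 e)
    rw [mul_comm]
    exact hcount e
  rw [abs_le] at hdev
  have hpos := (hA.likelihood_pos (f := f) (y := y) hh N θs).le
  rw [hA.likelihood_eq_mul_exp θs y h N θ]
  constructor
  · refine mul_le_mul_of_nonneg_left (Real.exp_le_exp.mpr ?_) hpos
    linarith [hdev.1]
  · refine mul_le_mul_of_nonneg_left (Real.exp_le_exp.mpr ?_) hpos
    linarith [hdev.2]

/-- The prior charges all neighbourhoods of the zeros of the entropy in the interior. -/
theorem setIntegral_prior_pos (hA : ConsistencyAssumptions Θ p f q ϖ ν)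
    (hν : IsStationary ϖ ν) (hf : ∀ e θ, IsDensity fun s => f s e θ) (hp : IsDensity p)
    {θs : Θ} (hθs : (θs : EuclideanSpace ℝ (Fin k)) ∈ interior Θ) {δ : ℝ} (hδ : 0 < δ) :
    0 < ∫ θ in {θ | hA.totalEntropy θs θ < δ}, p θ := by
  rw [setIntegral_pos_iff_support_of_nonneg_ae (Eventually.of_forall hp.nonneg)
    hp.integrable.integrableOn,
    show Function.support p = Set.univ from Set.eq_univ_of_forall fun θ => (hA.prior_pos θ).ne',
    Set.univ_inter]
  refine volume_subtype_pos_of_mem_interior hA.isCompact.measurableSet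
    (isOpen_lt (hA.totalEntropy θs).continuous continuous_const) ?_ hθs
  simp [totalEntropy, ContinuousMap.sum_apply, hA.entropy_self hν hf, hδ]

/-- Along good data, the predictive expectations converge to the true ones, uniformly over
uniformly bounded random variables. -/
theorem eventually_predictiveExpect_close [SFinite (volume : Measure S)]
    (hA : ConsistencyAssumptions Θ p f q ϖ ν)
    (hν : IsStationary ϖ ν) (hf : ∀ e θ, IsDensity fun s => f s e θ)
    (hq : ∀ e, IsDensity fun s => q s e) (hp : IsDensity p) {θs : Θ}
    (hθs : (θs : EuclideanSpace ℝ (Fin k)) ∈ interior Θ)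
    (hspec : IsCorrectlySpecified f q θs)
    {y : ℕ → S} {h : ℕ → H} (hh : ∀ i, 0 < ϖ (h i) (h (i + 1))) {b : ℝ} (hb0 : 0 < b)
    (hb : ∀ e, ∀ᶠ N : ℕ in atTop, b * N ≤ Nat.count (fun i => h i = e) N)
    (havg : Tendsto (fun N : ℕ => (N : ℝ)⁻¹ • ∑ i ∈ Finset.range N,
      (hA.logRatio θs (y i) (h i) - ∫ s, hA.logRatio θs s (h i) ∂densityMeasure q (h i)))
      atTop (𝓝 0)) (C : ℝ) {ε : ℝ} (hε : 0 < ε) : ∀ᶠ N : ℕ in atTop, ∀ e g, IsBoundedRV g →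
      (∀ s, |g s| ≤ C) →
      |predictiveExpect f (posterior f ϖ p y h N) e g - condExpect q e g| ≤ ε := by
  set K := hA.totalEntropy θs
  have hent0 := hA.entropy_nonneg hν hf hq hspec
  have hK : ∀ θ, K θ = ∑ e, hA.entropy θs e θ := fun θ => by
    simp [K, totalEntropy, ContinuousMap.sum_apply]
  have hK0 : ∀ θ, 0 ≤ K θ := fun θ => by
    rw [hK]
    exact Finset.sum_nonneg fun e _ => hent0 e θ
  have hKb : IsBoundedRV K := ⟨K.continuous.measurable, ‖K‖, fun θ => K.norm_coe_le_norm θ⟩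
  have hlim := tendsto_weighted_average_zero hp K.continuous.measurable hK0
    (fun θ => (le_abs_self _).trans (K.norm_coe_le_norm θ))
    (fun δ hδ => hA.setIntegral_prior_pos hν hf hp hθs hδ)
    (hA.isBoundedRV_likelihood y h) (fun N => hA.likelihood_pos hh N θs) hb0
    fun ε hε => hA.eventually_likelihood_bounds hν hf hq hspec hh hb havg hε
  set C' := max C 1
  have hC' : 0 < C' := one_pos.trans_le (le_max_right _ _)
  -- The error has two parts of size `ε / 2`: the term `2 * t * C'`, and `C' / (2 * t)` times the
  -- posterior mean of `K` once that mean is below `(2 * t) ^ 2`. Taking `C'` at least `1` keeps the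
  -- division legitimate for every `C`.
  set t := ε / (4 * C') with ht
  have ht0 : 0 < t := by positivity
  have hη : 0 < 2 * t * (2 * t) := by positivity
  filter_upwards [hlim.eventually_lt_const hη] with N hN e g hg hgC
  have hpN := hA.isDensity_posterior hp (y := y) hh N
  have hin := (hA.isBoundedRV_integral hf e hg).integrable_mul hpN.integrable
  have hKi := hKb.integrable_mul hpN.integrable
  have hdiff : predictiveExpect f (posterior f ϖ p y h N) e g - condExpect q e g =
      ∫ θ, ((∫ s, g s * f s e θ) - condExpect q e g) * posterior f ϖ p y h N θ := by
    simp only [sub_mul]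
    rw [integral_sub hin (hpN.integrable.const_mul _), integral_const_mul, hpN.integral_eq_one,
      mul_one, predictiveExpect]
  rw [hdiff, ← Real.norm_eq_abs]
  have hbnd : Integrable fun θ => C' / (2 * t) * (K θ * posterior f ϖ p y h N θ) +
      C' * (2 * t) * posterior f ϖ p y h N θ :=
    (hKi.const_mul _).add (hpN.integrable.const_mul _)
  refine (norm_integral_le_of_norm_le hbnd (Eventually.of_forall fun θ => ?_)).trans ?_
  · rw [norm_mul, Real.norm_of_nonneg (hpN.nonneg θ)]
    have h1 := hA.abs_integral_sub_le_entropy hν hf hq hspec e θ hg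
      (fun s => (hgC s).trans (le_max_left C 1)) ht0
    have h2 : hA.entropy θs e θ ≤ K θ := by
      rw [hK]
      exact Finset.single_le_sum (fun e _ => hent0 e θ) (Finset.mem_univ e)
    have h3 : |(∫ s, g s * f s e θ) - condExpect q e g| ≤ C' / (2 * t) * K θ + C' * (2 * t) := by
      refine h1.trans ?_
      calc C' * (hA.entropy θs e θ / (2 * t) + 2 * t)
          ≤ C' * (K θ / (2 * t) + 2 * t) := by gcongr
        _ = _ := by ring
    calc _ ≤ (C' / (2 * t) * K θ + C' * (2 * t)) * posterior f ϖ p y h N θ :=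
          mul_le_mul_of_nonneg_right h3 (hpN.nonneg θ)
      _ = _ := by ring
  · rw [integral_add (hKi.const_mul _) (hpN.integrable.const_mul _), integral_const_mul,
      integral_const_mul, hpN.integral_eq_one]
    have h1 : ∫ θ, K θ * posterior f ϖ p y h N θ ≤ 2 * t * (2 * t) := hN.le
    calc C' / (2 * t) * (∫ θ, K θ * posterior f ϖ p y h N θ) + C' * (2 * t) * 1
        ≤ C' / (2 * t) * (2 * t * (2 * t)) + C' * (2 * t) * 1 := by gcongr
      _ = ε := by
          rw [ht]
          field_simp
          ring

end ConsistencyAssumptions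

end ContextualControl

/-! ### Almost sure convergence of the Bayesian value functions -/

open ContextualControl in
theorem mainTheorem2 {n m d k : ℕ} {H : Type*} [Fintype H] [DecidableEq H] [MeasurableSpace H]
    [MeasurableSingletonClass H]
    (X : Set (EuclideanSpace ℝ (Fin n))) (U : Set (EuclideanSpace ℝ (Fin m)))
    (Ξ : Set (EuclideanSpace ℝ (Fin d))) (Θ : Set (EuclideanSpace ℝ (Fin k)))
    (hU : U.Nonempty) (hΞ : IsClosed Ξ)
    (c : X → U → Ξ → ℝ) (hc : Measurable fun w : X × U × Ξ => c w.1 w.2.1 w.2.2)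
    (hcb : ∃ C : ℝ, ∀ x u s, |c x u s| ≤ C)
    (F : X → U → Ξ → X) (hF : Measurable fun w : X × U × Ξ => F w.1 w.2.1 w.2.2)
    (γ : ℝ) (hγ : γ ∈ Set.Ioo (0 : ℝ) 1)
    (ϖ : Matrix H H ℝ) (hϖ : ϖ ∈ Matrix.rowStochastic ℝ H)
    (ν : H → ℝ) (hν : IsStationary ϖ ν)
    (q : Ξ → H → ℝ) (hq : ∀ e, IsDensity fun s => q s e)
    (f : Ξ → H → Θ → ℝ) (hf : ∀ e θ, IsDensity fun s => f s e θ)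
    (p : Θ → ℝ) (hp : IsDensity p)
    {Ω : Type*} [MeasurableSpace Ω] (P : Measure Ω) [IsProbabilityMeasure P]
    (η₁ : H) (ξ : ℕ → Ω → Ξ) (η : ℕ → Ω → H) (hdata : IsDataProcess P ϖ q η₁ ξ η)
    (hA : ConsistencyAssumptions Θ p f q ϖ ν)
    (θs : Θ) (hθs : (θs : EuclideanSpace ℝ (Fin k)) ∈ interior Θ)
    (hspec : IsCorrectlySpecified f q θs) (hident : IsIdentifiable f θs) :
    ∃ Vstar : X × H → ℝ, IsValueFunction c F γ ϖ (condExpect q) Vstar ∧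
      ∀ᵐ ω ∂P, ∃ V : ℕ → X × H → ℝ,
        (∀ N, 1 ≤ N → IsValueFunction c F γ ϖ
          (predictiveExpect f (posterior f ϖ p (fun i => ξ i ω) (fun i => η i ω) N)) (V N)) ∧
        Tendsto (fun N => ⨆ z, |V N z - Vstar z|) atTop (𝓝 0) := by
  have : Nonempty U := hU.to_subtype
  have : CompactSpace Θ := isCompact_iff_compactSpace.mp hA.isCompact
  let _ : MeasurableSpace C(Θ, ℝ) := borel _
  have : BorelSpace C(Θ, ℝ) := ⟨rfl⟩
  -- Closedness of `Ξ` makes its Lebesgue measure finite on compacts of a locally compact space,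
  -- hence s-finite, as integration over `Ξ` with a parameter requires.
  have : LocallyCompactSpace Ξ := hΞ.isClosedEmbedding_subtypeVal.locallyCompactSpace
  have : IsFiniteMeasureOnCompacts (volume : Measure Ξ) :=
    IsFiniteMeasureOnCompacts.comap' volume continuous_subtype_val
      (MeasurableEmbedding.subtype_coe hΞ.measurableSet)
  have hEq := isExpectation_condExpect hq
  obtain ⟨Vstar, hVstar⟩ := exists_isValueFunction (F := F) hcb hγ hϖ hEq
  refine ⟨Vstar, hVstar, ?_⟩
  choose b hb0 hb using hdata.ae_eventually_le_count hq hϖ hA.irreducible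
  -- There are finitely many contexts, so one lower frequency works for all of them.
  obtain ⟨β, hβ0, hβ⟩ : ∃ β > 0, ∀ e, β ≤ b e := by
    have : Nonempty H := ⟨η₁⟩
    obtain ⟨e, he⟩ := Finite.exists_min b
    exact ⟨b e, hb0 e, he⟩
  have havg := hdata.ae_tendsto_average hq hϖ (g := hA.logRatio θs)
    (fun e => (hA.integrable_logRatio hν hf θs e).1)
    fun e => (hA.integrable_logRatio hν hf θs e).2
  filter_upwards [hdata.ae_transition_pos hq hϖ, ae_all_iff.mpr hb, havg] with ω hpos hcount havg
  have hEN := fun N e => isExpectation_predictiveExpect hf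
    (fun e g hg => hA.isBoundedRV_integral hf e hg)
    (hA.isDensity_posterior hp (y := fun i => ξ i ω) (h := fun i => η i ω) hpos N) e
  choose V hV using fun N => exists_isValueFunction (F := F) hcb hγ hϖ (hEN N)
  refine ⟨V, fun N _ => hV N, ?_⟩
  obtain ⟨Cc, hCc⟩ := hcb
  obtain ⟨CV, hCV⟩ := hVstar.1.1
  have hγ1 : 0 < 1 - γ := by linarith [hγ.2]
  rw [Metric.tendsto_nhds]
  intro ε hε
  have hclose := hA.eventually_predictiveExpect_close hν hf hq hp hθs hspec hpos hβ0
    (fun e => (hcount e).mono fun N hN =>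
      (mul_le_mul_of_nonneg_right (hβ e) (Nat.cast_nonneg N)).trans hN)
    havg (Cc + γ * CV) (show 0 < ε / 2 * (1 - γ) by positivity)
  filter_upwards [hclose] with N hN
  have hz := abs_valueFunction_sub_le hCc hγ hϖ hEq (hEN N) hVstar.1 (hV N).1 hCV hN
  rw [mul_div_cancel_right₀ _ hγ1.ne'] at hz
  -- `X` may be empty; the real supremum is then `0`, which the bounds below allow for.
  rw [Real.dist_eq, sub_zero, abs_of_nonneg (Real.iSup_nonneg fun z => abs_nonneg _)]
  exact (Real.iSup_le hz (half_pos hε).le).trans_lt (half_lt_self hε)
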